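/- **Setting.** Let $(\Omega,\mathcal F,\mathbb P)$ be a probability space with a flow $(\theta_t)_{t\in\mathbb R}$ ($\theta_0=\mathrm{id}$, $\theta_{t+\tau}=\theta_t\circ\theta_\tau$) such that $(t,\omega)\mapsto\theta_t\omega$ is measurable, and let $\mathbb P$ be invariant and ergodic under $\theta$. Let $V\subset H\subset V'$ be a rigged real Hilbert space with $H$ separable and $V$ densely and compactly embedded in $H$, with duality pairing $\langle\cdot,\cdot\rangle$. Let $A$ be a positive self-adjoint operator in $H$ with $D(A^{1/2})=V$ and $\|\cdot\|_V=\|A^{1/2}\cdot\|_H$, extended to $A:V\to V'$ by $\langle Au,v\rangle=(A^{1/2}u,A^{1/2}v)_H$. Let $F:V\times\Omega\to H$ be such that $F(u,\cdot)$ is measurable for every $u\in V$. Let $\phi:[0,\infty)\times\Omega\times H\to H$ be a jointly measurable cocycle, that is $\phi(0,\omega,x)=x$ and $\phi(t+\tau,\omega,x)=\phi(t,\theta_\tau\omega,\phi(\tau,\omega,x))$, with $x\mapsto\phi(t,\omega,x)$ continuous for all $(t,\omega)$, generated by $$\frac{du}{dt}+Au=F(u,\theta_t\omega),\qquad u(0)=x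 .$$ This means: for all $\omega\in\Omega$ and $x\in H$, the function $u(t)=\phi(t,\omega,x)$ is in $C([0,\infty);H)\cap L^2_{\rm loc}((0,\infty);V)$, satisfies $u(0)=x$, the function $t\mapsto F(u(t),\theta_t\omega)$ is in $L^1_{\rm loc}((0,\infty);H)$, and for all $y\in V$ and $0<s\le t$ $$(u(t)-u(s),y)_H+\int_s^t\langle Au(r),y\rangle\,dr=\int_s^t (F(u(r),\theta_r\omega),y)_H\,dr .$$ Let $B(\omega)\subset V$ ($\omega\in\Omega$) be a random set, compact in $H$ (so $\omega\mapsto\mathrm{dist}_H(h,B(\omega))$ is measurable for each $h\in H$), which is * forward invariant: $\phi(t,\omega,B(\omega))\subset B(\theta_t\omega)$ for all $t>0$ and $\omega\in\Omega$; * forward absorbing: for every $H$-valued random variable $x$ and every $\varepsilon>0$ there is $T>0$ such that $\mathbb P\{\phi(t,\omega,x(\omega))\in B(\theta_t\omega)\}\ge 1-\varepsilon$ for all $t\ge T$. A random variable $\rho\ge0$ is *tempered* if $\lim_{t\to\pm\infty}|t|^{-1}\log^+\rho(\theta_t\omega)=0$ almost surely. Assume that, almost surely, $\sup_{x\in B(\omega)}\|x\|_V^2$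 is bounded by a tempered random variable and $t\mapsto\sup_{x\in B(\theta_t\omega)}\|x\|_V^2$ is locally integrable on $\mathbb R$. For continuous linear functionals $l_1,\dots,l_k$ on $V$, linearly independent, $\mathcal L=\{l_1,\dots,l_k\}$, the *completeness defect* of $\mathcal L$ with respect to $(V,H)$ is $$\varepsilon_{\mathcal L}=\sup\{\|w\|_H:\ w\in V,\ l_j(w)=0\ (j=1,\dots,k),\ \|w\|_V\le1\}.$$ **Theorem.** Suppose that there are a constant $c>0$ and a measurable function $l:V\times V\times\Omega\to[0,\infty)$ such that for all $\omega\in\Omega$ and $x_1,x_2\in B(\omega)$ $$\langle -A(x_1-x_2)+F(x_1,\omega)-F(x_2,\omega),\,x_1-x_2\rangle\le -c\|x_1-x_2\|_V^2+l(x_1,x_2,\omega)\|x_1-x_2\|_H^2 ,$$ and that for some $m>0$ $$\frac1m\,\mathbb E\Big\{\sup_{x_1,x_2\in B(\omega)}\int_0^m l\big(\phi(t,\omega,x_1),\phi(t,\omega,x_2),\theta_t\omega\big)\,dt\Big\}<c\,\varepsilon_{\mathcal L}^{-2}$$ (the supremum being a random variable up to null sets; for $\varepsilon_{\mathcal L}=0$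 the right-hand side is $+\infty$). Then $\mathcal L$ is asymptotically determining in probability for $\phi$: for any two (deterministic or random, $H$-valued) initial conditions $x_1,x_2$, if $$\int_t^{t+1}\max_{j}\big|l_j\big(\phi(\tau,\omega,x_1)-\phi(\tau,\omega,x_2)\big)\big|^2\,d\tau\longrightarrow0\quad\text{in probability as }t\to\infty,$$ then $$\|\phi(t,\omega,x_1)-\phi(t,\omega,x_2)\|_H\longrightarrow0\quad\text{in probability as }t\to\infty .$$ -/

import Mathlib

open MeasureTheory Filter Topology Set
open scoped ENNReal NNReal RealInnerProductSpace

noncomputable section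

namespace DetFunctionals

/-! ### Noise and cocycles -/

section Dynamics

variable {Ω : Type*} [MeasurableSpace Ω]

/-- `θ` is a jointly measurable, `P`-preserving and ergodic flow on `Ω` (a metric dynamical
system). Ergodic: every measurable set that is invariant under the whole flow is trivial. -/
structure IsMetricDynamicalSystem (P : Measure Ω) (θ : ℝ → Ω → Ω) : Prop where
  measurable : Measurable (fun p : ℝ × Ω => θ p.1 p.2)
  zero : θ 0 = id
  add : ∀ t τ : ℝ, θ (t + τ) = θ t ∘ θ τ
  measurePreserving : ∀ t : ℝ, MeasurePreserving (θ t) P P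
  ergodic : ∀ s : Set Ω, MeasurableSet s → (∀ t : ℝ, θ t ⁻¹' s = s) → P s = 0 ∨ P s = 1

/-- `φ` is a continuous random dynamical system with phase space `H` over the flow `θ`. -/
structure IsContinuousRDS {H : Type*} [TopologicalSpace H] [MeasurableSpace H]
    (θ : ℝ → Ω → Ω) (φ : ℝ≥0 → Ω → H → H) : Prop where
  measurable : Measurable (fun p : ℝ≥0 × Ω × H => φ p.1 p.2.1 p.2.2)
  zero : ∀ ω x, φ 0 ω x = x
  cocycle : ∀ (t τ : ℝ≥0) (ω : Ω) (x : H), φ (t + τ) ω x = φ t (θ τ ω) (φ τ ω x)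
  continuous : ∀ (t : ℝ≥0) (ω : Ω), Continuous (φ t ω)

/-- A nonnegative random variable `X` is tempered if `log⁺ X(θ_t ω) / |t| → 0` as `t → ±∞`,
almost surely. -/
structure IsTempered (P : Measure Ω) (θ : ℝ → Ω → Ω) (X : Ω → ℝ) : Prop where
  measurable : Measurable X
  nonneg : ∀ ω, 0 ≤ X ω
  tendsto_atTop : ∀ᵐ ω ∂P, Tendsto (fun t : ℝ => Real.posLog (X (θ t ω)) / |t|) atTop (𝓝 0)
  tendsto_atBot : ∀ᵐ ω ∂P, Tendsto (fun t : ℝ => Real.posLog (X (θ t ω)) / |t|) atBot (𝓝 0)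

end Dynamics

/-! ### The rigged space `V ⊂ H ⊂ V'` and the operator `A` -/

section Rigged

variable {V H : Type*} [NormedAddCommGroup V] [InnerProductSpace ℝ V]
  [NormedAddCommGroup H] [InnerProductSpace ℝ H]

/-- The `V`-valued version of a point of `H` (zero outside `V`). -/
def toV (ι : V →L[ℝ] H) (h : H) : V := Function.extend ι id (fun _ => 0) h

theorem toV_apply {ι : V →L[ℝ] H} (hι : Function.Injective ι) (v : V) : toV ι (ι v) = v :=
  hι.extend_apply _ _ _

variable [CompleteSpace H]

/-- A positive self-adjoint (in general unbounded) operator. -/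
structure IsPositiveSelfAdjoint (T : H →ₗ.[ℝ] H) : Prop where
  selfAdjoint : IsSelfAdjoint T
  nonneg : ∀ x : T.domain, 0 ≤ ⟪T x, (x : H)⟫

/-- `R` is the positive self-adjoint square root `A^{1/2}` of `A`: `R ∘ R = A`, with the natural
domain of the composition. -/
structure IsPositiveSqrt (R A : H →ₗ.[ℝ] H) : Prop where
  positive : IsPositiveSelfAdjoint R
  sq : ∀ x y : H, (x, y) ∈ A.graph ↔ ∃ z : H, (x, z) ∈ R.graph ∧ (z, y) ∈ R.graph

/-- The setting of the evolution equation: `V` is embedded in `H` by `ι`, densely and compactly;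
`A` is a positive self-adjoint operator in `H` with square root `R = A^{1/2}`, `D(A^{1/2}) = V`,
and `‖v‖_V = ‖A^{1/2} v‖_H`. -/
structure IsEnergyTriple (ι : V →L[ℝ] H) (A R : H →ₗ.[ℝ] H) : Prop where
  injective : Function.Injective ι
  denseRange : DenseRange ι
  compact : IsCompactOperator ι
  positive : IsPositiveSelfAdjoint A
  sqrt : IsPositiveSqrt R A
  domain_eq : (R.domain : Set H) = range ι
  norm_eq : ∀ (v : V) (h : ι v ∈ R.domain), ‖R ⟨ι v, h⟩‖ = ‖v‖

/-- The embedding `H ⊂ V'`: `⟨h, v⟩ = (h, v)_H`. -/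
def toDual (ι : V →L[ℝ] H) (h : H) : StrongDual ℝ V := (innerSL ℝ h).comp ι

/-- The operator `A` as a bounded operator `V → V'`, that is
`⟨A u, v⟩ = (A^{1/2} u, A^{1/2} v)_H = (u, v)_V`. -/
def energyOp : V →L[ℝ] StrongDual ℝ V := innerSL ℝ

/-- `energyOp` extends `A`: on `D(A)` it agrees with `A` under the embedding `H ⊂ V'`. -/
theorem energyOp_eq_toDual {ι : V →L[ℝ] H} {A R : H →ₗ.[ℝ] H} (h : IsEnergyTriple ι A R)
    (u : V) (hu : ι u ∈ A.domain) :
    energyOp u = toDual ι (A ⟨ι u, hu⟩) := by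
  have hmem : ∀ v : V, ι v ∈ R.domain := fun v => by
    have hv : ι v ∈ (R.domain : Set H) := by rw [h.domain_eq]; exact ⟨v, rfl⟩
    exact hv
  have hpol : ∀ v w : V, ⟪R ⟨ι v, hmem v⟩, R ⟨ι w, hmem w⟩⟫ = ⟪v, w⟫ := by
    intro v w
    have hs : R ⟨ι (v + w), hmem (v + w)⟩ = R ⟨ι v, hmem v⟩ + R ⟨ι w, hmem w⟩ := by
      rw [← LinearPMap.map_add]
      congr 1
      exact Subtype.ext (map_add ι v w)
    have h1 := h.norm_eq (v + w) (hmem _)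
    rw [hs] at h1
    rw [real_inner_eq_norm_add_mul_self_sub_norm_mul_self_sub_norm_mul_self_div_two,
      real_inner_eq_norm_add_mul_self_sub_norm_mul_self_sub_norm_mul_self_div_two, h1,
      h.norm_eq v, h.norm_eq w]
  ext v
  obtain ⟨z, hz1, hz2⟩ := (h.sqrt.sq (ι u) (A ⟨ι u, hu⟩)).1 (A.mem_graph ⟨ι u, hu⟩)
  obtain ⟨a, ha, rfl⟩ := (LinearPMap.mem_graph_iff R).1 hz1
  obtain ⟨b, hb, hb'⟩ := (LinearPMap.mem_graph_iff R).1 hz2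
  have ha' : a = ⟨ι u, hmem u⟩ := Subtype.ext ha
  subst ha'
  have hadj := LinearPMap.adjoint_isFormalAdjoint h.sqrt.positive.selfAdjoint.dense_domain
  have hself : R.adjoint = R := h.sqrt.positive.selfAdjoint
  rw [hself] at hadj
  have h2 := hadj b ⟨ι v, hmem v⟩
  simp only [hb', hb] at h2
  change ⟪u, v⟫ = ⟪A ⟨ι u, hu⟩, ι v⟫
  rw [← hpol u v, h2]

/-- `u` is a weak solution on `[0, ∞)`, for the noise path `t ↦ θ_t ω`, of
`du/dt + A u = F(u, θ_t ω)`, `u(0) = x`: it lies in `C([0,∞); H) ∩ L²_loc((0,∞); V)`,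
`F(u(t), θ_t ω)` is locally integrable in `H`, and the equation holds in `V'`, tested with
every `y ∈ V` and integrated in time. -/
structure IsWeakSolution {Ω : Type*} (ι : V →L[ℝ] H) (F : V → Ω → H) (θ : ℝ → Ω → Ω) (ω : Ω)
    (x : H) (u : ℝ → H) : Prop where
  initial : u 0 = x
  continuousOn : ContinuousOn u (Ici 0)
  mem_V : ∀ᵐ t ∂(volume.restrict (Ioi (0 : ℝ))), u t ∈ range ι
  memLp : ∀ a b : ℝ, 0 < a → MemLp (fun t => toV ι (u t)) 2 (volume.restrict (Icc a b))
  integrableOn : ∀ a b : ℝ, 0 < a →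
    IntegrableOn (fun t => F (toV ι (u t)) (θ t ω)) (Icc a b)
  equation : ∀ (y : V) (s t : ℝ), 0 < s → s ≤ t →
    toDual ι (u t) y - toDual ι (u s) y + ∫ r in s..t, energyOp (toV ι (u r)) y
      = ∫ r in s..t, toDual ι (F (toV ι (u r)) (θ r ω)) y

/-- The cocycle `φ` is generated by `du/dt + A u = F(u, θ_t ω)`: its trajectories solve it. -/
def IsGeneratedBy {Ω : Type*} (ι : V →L[ℝ] H) (F : V → Ω → H) (θ : ℝ → Ω → Ω)
    (φ : ℝ≥0 → Ω → H → H) : Prop :=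
  ∀ ω x, IsWeakSolution ι F θ ω x (fun t => φ t.toNNReal ω x)

/-! ### Absorbing random sets -/

/-- `B` is a random set in `V` that is compact in `H`. -/
structure IsCompactRandomSet {Ω : Type*} [MeasurableSpace Ω] (ι : V →L[ℝ] H)
    (B : Ω → Set V) : Prop where
  isCompact : ∀ ω, IsCompact (ι '' B ω)
  measurable : ∀ h : H, Measurable (fun ω => Metric.infEDist h (ι '' B ω))

/-- Forward invariance: `φ(t, ω, B(ω)) ⊂ B(θ_t ω)` for `t > 0`. -/
def IsForwardInvariant {Ω : Type*} (ι : V →L[ℝ] H) (θ : ℝ → Ω → Ω) (φ : ℝ≥0 → Ω → H → H)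
    (B : Ω → Set V) : Prop :=
  ∀ (t : ℝ≥0) (ω : Ω), 0 < t → φ t ω '' (ι '' B ω) ⊆ ι '' B (θ t ω)

/-- Forward absorption: for each random variable `x` in `H` and `ε > 0`,
`φ(t, ω, x(ω)) ∈ B(θ_t ω)` with probability at least `1 - ε` for all large `t`. -/
def IsForwardAbsorbing {Ω : Type*} [MeasurableSpace Ω] [MeasurableSpace H] (P : Measure Ω)
    (ι : V →L[ℝ] H) (θ : ℝ → Ω → Ω) (φ : ℝ≥0 → Ω → H → H) (B : Ω → Set V) : Prop :=
  ∀ x : Ω → H, Measurable x → ∀ ε : ℝ, 0 < ε → ∃ T : ℝ≥0, 0 < T ∧ ∀ t : ℝ≥0, T ≤ t →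
    ENNReal.ofReal (1 - ε) ≤ P {ω | φ t ω (x ω) ∈ ι '' B (θ t ω)}

/-- `sup_{x ∈ S} ‖x‖_V²`, as an extended real. -/
def supNormSq (S : Set V) : ℝ≥0∞ := ⨆ x ∈ S, ENNReal.ofReal (‖x‖ ^ 2)

/-- `sup_{x₁, x₂ ∈ B(ω)} ∫_0^m l(φ(t, ω, x₁), φ(t, ω, x₂), θ_t ω) dt`, as an extended real. -/
def supWeight {Ω : Type*} (ι : V →L[ℝ] H) (θ : ℝ → Ω → Ω) (φ : ℝ≥0 → Ω → H → H)
    (B : Ω → Set V) (l : V → V → Ω → ℝ) (m : ℝ) (ω : Ω) : ℝ≥0∞ :=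
  ⨆ x₁ ∈ B ω, ⨆ x₂ ∈ B ω, ∫⁻ t in Icc 0 m,
    ENNReal.ofReal
      (l (toV ι (φ t.toNNReal ω (ι x₁))) (toV ι (φ t.toNNReal ω (ι x₂))) (θ t ω))

/-! ### Functionals -/

/-- The completeness defect `sup {‖w‖_H : w ∈ V, l_j(w) = 0 for all j, ‖w‖_V ≤ 1}`. -/
def completenessDefect (ι : V →L[ℝ] H) {k : ℕ} (L : Fin k → StrongDual ℝ V) : ℝ≥0∞ :=
  ⨆ w ∈ {w : V | (∀ j, L j w = 0) ∧ ‖w‖ ≤ 1}, ENNReal.ofReal ‖ι w‖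

/-- The set `{l_j}` of functionals on `V` is asymptotically determining in probability for `φ`.
The initial conditions may be random; deterministic ones are the constant functions. -/
def IsDeterminingInProbability {Ω : Type*} [MeasurableSpace Ω] [MeasurableSpace H]
    (P : Measure Ω) (ι : V →L[ℝ] H) (φ : ℝ≥0 → Ω → H → H) {k : ℕ}
    (L : Fin k → StrongDual ℝ V) : Prop :=
  ∀ x₁ x₂ : Ω → H, Measurable x₁ → Measurable x₂ →
    TendstoInMeasure P
      (fun (t : ℝ) ω => ∫ τ in t..(t + 1),
        ⨆ j, |L j (toV ι (φ τ.toNNReal ω (x₁ ω) - φ τ.toNNReal ω (x₂ ω)))| ^ 2)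
      atTop (fun _ => 0) →
    TendstoInMeasure P
      (fun (t : ℝ) ω => ‖φ t.toNNReal ω (x₁ ω) - φ t.toNNReal ω (x₂ ω)‖)
      atTop (fun _ => 0)

end Rigged

end DetFunctionals

end

namespace DetFunctionals

/-! ### Absolutely continuous functions -/

section AbsolutelyContinuous

/-! Let `w` be the difference of two trajectories that have both entered the absorbing set by time
`a`; by forward invariance they stay there. The energy equality and the dissipativity hypothesis
give `d/dt ‖w‖_H² ≤ -2c‖w‖_V² + 2l‖w‖_H²`. If `κ ε_L² < c`, then `c‖w‖_V²` dominates `κ‖w‖_H²` up to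
a multiple of `max_j |l_j(w)|²` (`exists_norm_sq_le_of_defect`), so Grönwall's inequality applies
with the coefficient `2(l - κ)` and the functionals as forcing (`norm_sub_sq_le_of_dissipative`).

On `[a, a + n]` the integral of `l` is at most one value of `supWeight` plus `1/m` times the
integral of `supWeight` along the noise orbit (`lintegral_weight_le`). The hypothesis on the mean
leaves room for rates `κ' < κ` with `E supWeight / m < κ'`, and by ergodicity the orbit integral
divided by `m` is below `n κ'` outside an event of small probability
(`tendsto_measure_le_lintegral_orbit`). The initial distance is thus damped by `exp(-2(κ - κ')n)`,
up to random factors evaluated at the entrance time.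

Convergence in probability allows a fixed window: first `n` is chosen, then `t → ∞` with `a = t -
n`. Invariance of `P` makes the bounds on the random factors uniform in `a`, absorption makes late
entrance unlikely, and the functional term is a sum of `n` unit-window integrals, each tending to
zero in probability.

The energy equality (`energy_equality`) is proved by expanding in a Hilbert basis of `V` whose
images in `H` are orthogonal: each coordinate satisfies a scalar equation, and the squares are
summed by dominated convergence. -/

theorem ae_hasDerivAt_add_integral {f : ℝ → ℝ} {a b : ℝ} (C : ℝ)
    (hf : IntervalIntegrable f volume a b) :
    ∀ᵐ x, x ∈ uIcc a b → HasDerivAt (fun x => C + ∫ t in a..x, f t) (f x) x := by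
  filter_upwards [hf.ae_hasDerivAt_integral] with x hx hxm
  exact (hx hxm a left_mem_uIcc).const_add C

theorem absolutelyContinuousOnInterval_add_integral {f : ℝ → ℝ} {a b : ℝ} (C : ℝ)
    (hf : IntervalIntegrable f volume a b) :
    AbsolutelyContinuousOnInterval (fun x => C + ∫ t in a..x, f t) a b := by
  have h1 : AbsolutelyContinuousOnInterval (fun _ : ℝ => C) a b :=
    (LipschitzWith.const C).lipschitzOnWith.absolutelyContinuousOnInterval
  exact h1.add (hf.absolutelyContinuousOnInterval_intervalIntegral left_mem_uIcc)

/-- The inner function takes values in some `[-C, C]`, where `exp` is Lipschitz with constant `exp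
C`. This supplies the integrating factor for Grönwall's inequality. -/
theorem absolutelyContinuousOnInterval_exp {f : ℝ → ℝ} {a b : ℝ}
    (hf : AbsolutelyContinuousOnInterval f a b) :
    AbsolutelyContinuousOnInterval (fun x => Real.exp (f x)) a b := by
  obtain ⟨C, hC⟩ := hf.exists_bound
  have hlip : ∀ x ∈ Icc (-C) C, ∀ y ∈ Icc (-C) C,
      dist (Real.exp x) (Real.exp y) ≤ Real.exp C * dist x y := by
    intro x hx y hy
    rw [dist_comm, dist_comm x, dist_eq_norm, dist_eq_norm]
    refine Convex.norm_image_sub_le_of_norm_deriv_le (s := Icc (-C) C)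
      (fun z _ => Real.differentiableAt_exp) (fun z hz => ?_) (convex_Icc _ _) hx hy
    rw [Real.deriv_exp, Real.norm_eq_abs, abs_of_pos (Real.exp_pos _)]
    exact Real.exp_le_exp.2 hz.2
  unfold AbsolutelyContinuousOnInterval at hf ⊢
  refine squeeze_zero' (.of_forall fun _ => Finset.sum_nonneg fun i _ => dist_nonneg) ?_
    (by simpa using hf.const_mul (Real.exp C))
  rw [eventually_inf_principal]
  filter_upwards with ⟨n, I⟩ hnI
  simp only [AbsolutelyContinuousOnInterval.disjWithin, mem_ofPred_eq] at hnI
  rw [Finset.mul_sum]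
  refine Finset.sum_le_sum fun i hi => hlip _ ?_ _ ?_
  · exact abs_le.1 (hC _ (hnI.1 i hi).1)
  · exact abs_le.1 (hC _ (hnI.1 i hi).2)

/-- Product rule for two functions given as primitives on `[a, b]`. -/
theorem integral_primitive_mul_primitive {f g f' g' : ℝ → ℝ} {a b : ℝ} (hab : a ≤ b)
    (hf' : IntervalIntegrable f' volume a b) (hg' : IntervalIntegrable g' volume a b)
    (hf : ∀ t ∈ Icc a b, f t = f a + ∫ r in a..t, f' r)
    (hg : ∀ t ∈ Icc a b, g t = g a + ∫ r in a..t, g' r) :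
    ∫ t in a..b, (f' t * g t + f t * g' t) = f b * g b - f a * g a := by
  have hF := absolutelyContinuousOnInterval_add_integral (f a) hf'
  have hG := absolutelyContinuousOnInterval_add_integral (g a) hg'
  have key := hF.integral_deriv_mul_eq_sub hG
  have hb : b ∈ Icc a b := right_mem_Icc.2 hab
  simp only [intervalIntegral.integral_same, add_zero, ← hf b hb, ← hg b hb] at key
  rw [← key]
  refine intervalIntegral.integral_congr_ae ?_
  filter_upwards [ae_hasDerivAt_add_integral (f a) hf', ae_hasDerivAt_add_integral (g a) hg']
    with x h1 h2 hx
  have hx' : x ∈ uIcc a b := uIoc_subset_uIcc hx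
  have hx'' : x ∈ Icc a b := by rwa [uIcc_of_le hab] at hx'
  rw [(h1 hx').deriv, (h2 hx').deriv, ← hf x hx'', ← hg x hx'']

/-- Grönwall's inequality for an absolutely continuous function with an integrable coefficient. -/
theorem gronwall_of_primitive {q D h p : ℝ → ℝ} {a b : ℝ} (hab : a ≤ b)
    (hD : IntervalIntegrable D volume a b) (hh : IntervalIntegrable h volume a b)
    (hp : IntervalIntegrable p volume a b)
    (hq : ∀ t ∈ Icc a b, q t = q a + ∫ r in a..t, D r)
    (hle : ∀ᵐ t, t ∈ Icc a b → D t ≤ h t * q t + p t) :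
    q b ≤ Real.exp (∫ r in a..b, h r) *
      (q a + ∫ t in a..b, Real.exp (-∫ r in a..t, h r) * p t) := by
  -- With the integrating factor `E = exp(-∫ h)`, the product `E q` is absolutely continuous and `(E
  -- q)' ≤ E p` almost everywhere.
  have hH := absolutelyContinuousOnInterval_add_integral 0 hh.neg
  have hE := absolutelyContinuousOnInterval_exp hH
  have hQ := absolutelyContinuousOnInterval_add_integral (q a) hD
  have key := hE.integral_deriv_mul_eq_sub hQ
  have hb : b ∈ Icc a b := right_mem_Icc.2 hab
  simp only [intervalIntegral.integral_same, add_zero, zero_add, ← hq b hb, Pi.neg_apply,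
    intervalIntegral.integral_neg, Real.exp_zero, one_mul] at key
  set E : ℝ → ℝ := fun t => Real.exp (-∫ r in a..t, h r) with hEdef
  have hEc : ContinuousOn E (uIcc a b) := by
    have := hE.continuousOn
    simpa only [zero_add, Pi.neg_apply, intervalIntegral.integral_neg] using this
  have hmono : (∫ t in a..b, (deriv E t * (q a + ∫ r in a..t, D r) +
      E t * deriv (fun x => q a + ∫ r in a..x, D r) t)) ≤ ∫ t in a..b, E t * p t := by
    refine intervalIntegral.integral_mono_ae_restrict hab ?_ (hp.continuousOn_mul hEc) ?_
    · have h1 := hE.intervalIntegrable_deriv.mul_continuousOn hQ.continuousOn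
      have h2 := hQ.intervalIntegrable_deriv.continuousOn_mul hE.continuousOn
      have := h1.add h2
      simpa only [zero_add, Pi.neg_apply, intervalIntegral.integral_neg] using this
    · rw [EventuallyLE, ae_restrict_iff' measurableSet_Icc]
      filter_upwards [ae_hasDerivAt_add_integral 0 hh.neg, ae_hasDerivAt_add_integral (q a) hD,
        hle] with x h1 h2 h3 hx
      have hx' : x ∈ uIcc a b := by rwa [uIcc_of_le hab]
      have hd : HasDerivAt E (E x * -h x) x := by
        have := (h1 hx').exp
        simpa only [zero_add, Pi.neg_apply, intervalIntegral.integral_neg] using this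
      rw [hd.deriv, (h2 hx').deriv, ← hq x hx]
      have := mul_le_mul_of_nonneg_left (h3 hx) (Real.exp_pos (-∫ r in a..x, h r)).le
      simp only [hEdef]
      linarith
  rw [key] at hmono
  have hpos := Real.exp_pos (∫ r in a..b, h r)
  have : q b = Real.exp (∫ r in a..b, h r) * (E b * q b) := by
    rw [← mul_assoc, hEdef, ← Real.exp_add]; simp
  rw [this]
  exact mul_le_mul_of_nonneg_left (by linarith) hpos.le

/-- Grönwall's inequality with the coefficient `2 (l - κ)`, where `l, p ≥ 0`. -/
theorem gronwall_of_primitive_sub {q D l p : ℝ → ℝ} {a b κ : ℝ} (hab : a ≤ b) (hκ : 0 ≤ κ)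
    (hD : IntervalIntegrable D volume a b) (hl : IntervalIntegrable l volume a b)
    (hp : IntervalIntegrable p volume a b) (hl0 : ∀ t, 0 ≤ l t)
    (hp0 : ∀ᵐ t, t ∈ Icc a b → 0 ≤ p t)
    (hq : ∀ t ∈ Icc a b, q t = q a + ∫ r in a..t, D r)
    (hle : ∀ᵐ t, t ∈ Icc a b → D t ≤ 2 * (l t - κ) * q t + p t) :
    q b ≤ Real.exp (2 * ∫ r in a..b, l r) *
      (Real.exp (-(2 * κ * (b - a))) * q a + ∫ t in a..b, p t) := by
  have hh : IntervalIntegrable (fun t => 2 * (l t - κ)) volume a b :=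
    (hl.sub intervalIntegrable_const).const_mul 2
  have hint : ∀ t ∈ Icc a b, ∫ r in a..t, 2 * (l r - κ) =
      2 * (∫ r in a..t, l r) - 2 * κ * (t - a) := by
    intro t ht
    rw [intervalIntegral.integral_const_mul, intervalIntegral.integral_sub _
      intervalIntegrable_const, intervalIntegral.integral_const, smul_eq_mul]
    · ring
    · exact hl.mono_set (by rw [uIcc_of_le hab, uIcc_of_le ht.1]; exact Icc_subset_Icc_right ht.2)
  have key := gronwall_of_primitive hab hD hh hp hq hle
  refine key.trans ?_
  rw [hint b (right_mem_Icc.2 hab), sub_eq_add_neg, Real.exp_add, mul_assoc]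
  refine mul_le_mul_of_nonneg_left ?_ (Real.exp_pos _).le
  rw [mul_add]
  gcongr
  rw [← intervalIntegral.integral_const_mul]
  have hcont : ContinuousOn (fun t => Real.exp (-∫ r in a..t, 2 * (l r - κ))) (uIcc a b) :=
    (intervalIntegral.continuousOn_primitive_interval' hh left_mem_uIcc).neg.rexp
  refine intervalIntegral.integral_mono_ae_restrict hab
    ((hp.continuousOn_mul hcont).const_mul _) hp ?_
  rw [EventuallyLE, ae_restrict_iff' measurableSet_Icc]
  filter_upwards [hp0] with t h0 ht
  rw [hint t ht, ← mul_assoc, ← Real.exp_add]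
  -- The combined exponent is `-2 ∫_a^t l - 2κ(b - t) ≤ 0`, so the weight in front of `p` is at most
  -- one and is dropped.
  refine mul_le_of_le_one_left (h0 ht) (Real.exp_le_one_iff.2 ?_)
  have h1 : 0 ≤ ∫ r in a..t, l r := intervalIntegral.integral_nonneg ht.1 fun r _ => hl0 r
  have h2 : 0 ≤ κ * (b - t) := mul_nonneg hκ (sub_nonneg.2 ht.2)
  linarith

end AbsolutelyContinuous

/-! ### Functionals and the completeness defect -/

section Functionals

variable {V H : Type*} [NormedAddCommGroup V] [InnerProductSpace ℝ V]
  [NormedAddCommGroup H] [InnerProductSpace ℝ H]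

theorem norm_le_completenessDefect {ι : V →L[ℝ] H} {k : ℕ} (L : Fin k → StrongDual ℝ V) {w : V}
    (hw : ∀ j, L j w = 0) :
    ENNReal.ofReal ‖ι w‖ ≤ completenessDefect ι L * ENNReal.ofReal ‖w‖ := by
  rcases eq_or_ne w 0 with rfl | h0
  · simp
  have hpos : 0 < ‖w‖ := norm_pos_iff.2 h0
  have hmem : (‖w‖⁻¹ • w) ∈ {w : V | (∀ j, L j w = 0) ∧ ‖w‖ ≤ 1} :=
    ⟨fun j => by simp [hw j], by rw [norm_smul, norm_inv, norm_norm, inv_mul_cancel₀ hpos.ne']⟩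
  have h1 := le_iSup₂ (f := fun (w : V) (_ : w ∈ {w : V | (∀ j, L j w = 0) ∧ ‖w‖ ≤ 1}) =>
    ENNReal.ofReal ‖ι w‖) _ hmem
  have h2 : ‖ι w‖ = ‖ι (‖w‖⁻¹ • w)‖ * ‖w‖ := by
    rw [map_smul, norm_smul, norm_inv, norm_norm]; field_simp
  rw [h2, ENNReal.ofReal_mul (norm_nonneg _)]
  exact mul_le_mul_left h1 _

theorem completenessDefect_ne_top (ι : V →L[ℝ] H) {k : ℕ} (L : Fin k → StrongDual ℝ V) :
    completenessDefect ι L ≠ ∞ := by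
  refine ne_top_of_le_ne_top (b := ENNReal.ofReal ‖ι‖) ENNReal.ofReal_ne_top ?_
  refine iSup₂_le fun w hw => ENNReal.ofReal_le_ofReal ?_
  exact (ι.le_opNorm w).trans (mul_le_of_le_one_right (norm_nonneg _) hw.2)

/-- If `κ ε_L² < c` then `κ ‖v‖_H² ≤ c ‖v‖_V² + C max_j |l_j(v)|²`. -/
theorem exists_norm_sq_le_of_defect [CompleteSpace V] (ι : V →L[ℝ] H) {k : ℕ}
    (L : Fin k → StrongDual ℝ V) {c κ : ℝ} (hκ : 0 ≤ κ)
    (h : κ * (completenessDefect ι L).toReal ^ 2 < c) :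
    ∃ C : ℝ, 0 ≤ C ∧ ∀ v : V, κ * ‖ι v‖ ^ 2 ≤ c * ‖v‖ ^ 2 + C * ⨆ j, |L j v| ^ 2 := by
  set ε := (completenessDefect ι L).toReal with hε
  have hε0 : 0 ≤ ε := ENNReal.toReal_nonneg
  set T : V →L[ℝ] (Fin k → ℝ) := ContinuousLinearMap.pi L with hT
  -- The defect controls only the common kernel `W`. On `Wᗮ` the map `T` is injective, so `Wᗮ` is
  -- finite-dimensional and `‖T ·‖` is equivalent to the norm there.
  set W : Submodule ℝ V := T.ker with hW
  have hWc : IsClosed (W : Set V) := T.isClosed_ker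
  have : CompleteSpace W := hWc.completeSpace_coe
  have hWw : ∀ w ∈ W, ‖ι w‖ ≤ ε * ‖w‖ := by
    intro w hw
    have hw' : ∀ j, L j w = 0 := fun j => congrFun (show T w = 0 from hw) j
    have h1 := ENNReal.toReal_mono (ENNReal.mul_ne_top (completenessDefect_ne_top ι L)
      ENNReal.ofReal_ne_top) (norm_le_completenessDefect (ι := ι) L hw')
    rwa [ENNReal.toReal_mul, ENNReal.toReal_ofReal (norm_nonneg _),
      ENNReal.toReal_ofReal (norm_nonneg _)] at h1
  -- `T` is bounded below on the complement of its kernel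
  obtain ⟨K, hK⟩ : ∃ K : ℝ≥0, ∀ x ∈ Wᗮ, ‖x‖ ≤ K * ‖T x‖ := by
    set g : Wᗮ →ₗ[ℝ] (Fin k → ℝ) := (T : V →ₗ[ℝ] (Fin k → ℝ)).comp Wᗮ.subtype with hg
    have hker : g.ker = ⊥ := by
      rw [LinearMap.ker_eq_bot']
      intro x hx
      have h1 : (x : V) ∈ W := hx
      have h2 := Submodule.inner_right_of_mem_orthogonal h1 x.2
      exact Subtype.ext (inner_self_eq_zero.1 h2)
    have : FiniteDimensional ℝ Wᗮ :=
      FiniteDimensional.of_injective g (LinearMap.ker_eq_bot.1 hker)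
    obtain ⟨K, -, hK⟩ := g.exists_antilipschitzWith hker
    refine ⟨K, fun x hx => ?_⟩
    have := hK.le_mul_dist ⟨x, hx⟩ 0
    simpa [hg] using this
  -- choice of the parameter in Young's inequality
  obtain ⟨η, hη, hηc⟩ : ∃ η > 0, κ * (1 + η) * ε ^ 2 ≤ c := by
    have h0 : 0 ≤ κ * ε ^ 2 := by positivity
    -- The `+ 1` keeps the denominator positive when `κ ε² = 0`.
    refine ⟨(c - κ * ε ^ 2) / (κ * ε ^ 2 + 1), div_pos (by linarith) (by linarith), ?_⟩
    have h1 : κ * ε ^ 2 * ((c - κ * ε ^ 2) / (κ * ε ^ 2 + 1)) ≤ c - κ * ε ^ 2 := by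
      rw [mul_div_assoc', div_le_iff₀ (by linarith)]
      nlinarith
    nlinarith
  refine ⟨κ * (1 + η⁻¹) * (‖ι‖ * K) ^ 2, by positivity, fun v => ?_⟩
  have hsup : ‖T v‖ ^ 2 ≤ ⨆ j, |L j v| ^ 2 := by
    have hbdd : BddAbove (range fun j => |L j v| ^ 2) := (finite_range _).bddAbove
    -- For `k = 0` the real supremum has the default value `0`, which is consistent because then `T
    -- v = 0`.
    have h0 : 0 ≤ ⨆ j, |L j v| ^ 2 := Real.iSup_nonneg fun j => by positivity
    rw [← Real.sqrt_le_sqrt_iff h0, Real.sqrt_sq (norm_nonneg _), pi_norm_le_iff_of_nonneg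
      (Real.sqrt_nonneg _)]
    intro j
    refine Real.le_sqrt_of_sq_le ?_
    have := le_ciSup hbdd j
    simpa [hT] using this
  set w : V := W.starProjection v with hw
  set z : V := v - w with hz
  have hwW : w ∈ W := W.starProjection_apply_mem v
  have hzW : z ∈ Wᗮ := W.sub_starProjection_mem_orthogonal v
  have hTz : T z = T v := by
    have : T w = 0 := hwW
    rw [hz, map_sub, this, sub_zero]
  have hwn : ‖w‖ ≤ ‖v‖ := W.norm_starProjection_apply_le v
  have h1 : ‖ι w‖ ≤ ε * ‖v‖ := (hWw w hwW).trans (by gcongr)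
  have h2 : ‖ι z‖ ≤ ‖ι‖ * K * ‖T v‖ := by
    rw [mul_assoc, ← hTz]
    exact (ι.le_opNorm z).trans (by gcongr; exact hK z hzW)
  have h3 : ‖ι v‖ ≤ ‖ι w‖ + ‖ι z‖ := by
    have : v = w + z := by rw [hz]; abel
    rw [this, map_add]; exact norm_add_le _ _
  have h4 : (‖ι w‖ + ‖ι z‖) ^ 2 ≤ (1 + η) * ‖ι w‖ ^ 2 + (1 + η⁻¹) * ‖ι z‖ ^ 2 := by
    have : 0 ≤ η⁻¹ * (η * ‖ι w‖ - ‖ι z‖) ^ 2 := by positivity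
    have e : η⁻¹ * (η * ‖ι w‖ - ‖ι z‖) ^ 2 =
        η * ‖ι w‖ ^ 2 - 2 * ‖ι w‖ * ‖ι z‖ + η⁻¹ * ‖ι z‖ ^ 2 := by
      field_simp
      ring
    nlinarith
  calc κ * ‖ι v‖ ^ 2 ≤ κ * ((1 + η) * ‖ι w‖ ^ 2 + (1 + η⁻¹) * ‖ι z‖ ^ 2) := by
        gcongr
        exact (pow_le_pow_left₀ (norm_nonneg _) h3 2).trans h4
    _ ≤ κ * ((1 + η) * (ε * ‖v‖) ^ 2 + (1 + η⁻¹) * (‖ι‖ * K * ‖T v‖) ^ 2) := by gcongr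
    _ = κ * (1 + η) * ε ^ 2 * ‖v‖ ^ 2 + κ * (1 + η⁻¹) * (‖ι‖ * K) ^ 2 * ‖T v‖ ^ 2 := by ring
    _ ≤ _ := by gcongr

end Functionals

/-! ### Eigenvectors of a compact embedding -/

section Embedding

universe u v

variable {V : Type u} {H : Type v} [NormedAddCommGroup V] [InnerProductSpace ℝ V] [CompleteSpace V]
  [NormedAddCommGroup H] [InnerProductSpace ℝ H] [CompleteSpace H]

/-- The adjoint `H → V` has dense range, because the orthogonal complement of its range is `ker ι =
0`. Separability of `V` gives countable bases, needed for dominated convergence along finite partial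
sums, and makes `toV` Borel measurable. -/
theorem separableSpace_of_injective [TopologicalSpace.SeparableSpace H] {ι : V →L[ℝ] H}
    (hι : Function.Injective ι) : TopologicalSpace.SeparableSpace V := by
  have hd : DenseRange (ContinuousLinearMap.adjoint ι) := by
    have h1 : (ContinuousLinearMap.adjoint ι).rangeᗮ = ⊥ := by
      rw [ContinuousLinearMap.orthogonal_range, ContinuousLinearMap.adjoint_adjoint]
      exact LinearMap.ker_eq_bot.2 hι
    have h2 := Submodule.topologicalClosure_eq_top_iff.2 h1
    have h3 := Submodule.dense_iff_topologicalClosure_eq_top.2 h2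
    exact h3
  exact hd.separableSpace (ContinuousLinearMap.adjoint ι).continuous

/-- Orthonormal vectors lie at mutual distance `√2`, so the balls of radius `1/2` about them are
disjoint. -/
theorem countable_of_orthonormal {E I : Type*} [NormedAddCommGroup E] [InnerProductSpace ℝ E]
    [TopologicalSpace.SeparableSpace E] {e : I → E} (he : Orthonormal ℝ e) : Countable I := by
  refine Pairwise.countable_of_isOpen_disjoint (s := fun i => Metric.ball (e i) (1 / 2))
    (fun i j hij => ?_) (fun i => Metric.isOpen_ball)
    (fun i => Metric.nonempty_ball.2 (by norm_num))
  refine Metric.ball_disjoint_ball ?_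
  have h1 : ‖e i - e j‖ ^ 2 = 2 := by
    rw [norm_sub_sq_real, he.1 i, he.1 j, he.2 hij]; norm_num
  rw [dist_eq_norm]
  nlinarith [norm_nonneg (e i - e j)]

/-- A compact injective operator `ι : V → H` has a Hilbert basis of singular vectors. -/
theorem exists_hilbertBasis_singular {ι : V →L[ℝ] H} (hι : Function.Injective ι)
    (hc : IsCompactOperator ι) :
    ∃ (I : Type u) (e : HilbertBasis I ℝ V) (μ : I → ℝ),
      (∀ i, 0 < μ i) ∧ ∀ i v, ⟪ι v, ι (e i)⟫ = μ i * ⟪v, e i⟫ := by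
  -- The basis diagonalizes the compact symmetric operator `ι* ι`: orthonormal bases of its
  -- eigenspaces are glued together, and injectivity of `ι` makes every eigenvalue positive.
  set S : V →L[ℝ] V := (ContinuousLinearMap.adjoint ι).comp ι with hS
  have hSin : ∀ v w, ⟪ι v, ι w⟫ = ⟪v, S w⟫ := fun v w => by
    simp [hS, ContinuousLinearMap.adjoint_inner_right]
  have hSc : IsCompactOperator S := hc.clm_comp (ContinuousLinearMap.adjoint ι)
  have hSs : (S : V →ₗ[ℝ] V).IsSymmetric := fun v w => by
    change ⟪S v, w⟫ = ⟪v, S w⟫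
    rw [← hSin, real_inner_comm, ← hSin, real_inner_comm]
  choose w b hb using fun μ : ℝ =>
    exists_hilbertBasis ℝ (Module.End.eigenspace (S : V →ₗ[ℝ] V) μ)
  have hortho := hSs.orthogonalFamily_eigenspaces.orthonormal_sigma_orthonormal
    (fun μ => (b μ).orthonormal)
  have hbot := ContinuousLinearMap.orthogonalComplement_iSup_eigenspaces_eq_bot hSc hSs
  have hcomp : (Submodule.span ℝ (range fun a : (Σ μ : ℝ, w μ) =>
      (Module.End.eigenspace (S : V →ₗ[ℝ] V) a.1).subtypeₗᵢ (b a.1 a.2)))ᗮ = ⊥ := by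
    rw [eq_bot_iff, ← hbot, ← Submodule.iInf_orthogonal]
    intro x hx
    rw [Submodule.mem_iInf]
    intro μ y hy
    have hx' : ∀ i : w μ, ⟪((b μ i : Module.End.eigenspace (S : V →ₗ[ℝ] V) μ) : V), x⟫ = 0 :=
      fun i => hx _ (Submodule.subset_span ⟨⟨μ, i⟩, rfl⟩)
    set p := (Module.End.eigenspace (S : V →ₗ[ℝ] V) μ).orthogonalProjectionOnto x
    -- Parseval's identity inside the eigenspace: a vector orthogonal to all basis vectors there is
    -- orthogonal to the whole eigenspace.
    have h0 := (b μ).hasSum_inner_mul_inner ⟨y, hy⟩ p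
    have hp : ∀ z : Module.End.eigenspace (S : V →ₗ[ℝ] V) μ, ⟪z, p⟫ = ⟪(z : V), x⟫ :=
      fun z => by simp [p]
    simp only [hp, hx', mul_zero] at h0
    exact h0.unique hasSum_zero
  set e := HilbertBasis.mkOfOrthogonalEqBot hortho hcomp with he
  have hev : ∀ i : (Σ μ : ℝ, w μ), S (e i) = i.1 • e i := by
    intro i
    have h1 : e i = (b i.1 i.2 : V) := by
      rw [he, HilbertBasis.coe_mkOfOrthogonalEqBot]; rfl
    rw [h1]
    exact Module.End.mem_eigenspace_iff.1 (b i.1 i.2).2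
  have hin : ∀ i v, ⟪ι v, ι (e i)⟫ = i.1 * ⟪v, e i⟫ := fun i v => by
    rw [hSin, hev, inner_smul_right]
  refine ⟨_, e, fun i => i.1, fun i => ?_, hin⟩
  have h1 := hin i (e i)
  have h2 : ‖e i‖ = 1 := e.orthonormal.1 i
  rw [real_inner_self_eq_norm_sq, real_inner_self_eq_norm_sq, h2] at h1
  have h3 : ι (e i) ≠ 0 := fun h => by
    have h4 : e i = 0 := hι (by rw [h, map_zero])
    rw [h4, norm_zero] at h2
    exact zero_ne_one h2
  have := norm_pos_iff.2 h3
  nlinarith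

/-! ### The energy equality -/

/-- The energy equality for a weak solution `v` of `dv/dt + A v = f` on `[a, b]`. -/
theorem energy_equality [TopologicalSpace.SeparableSpace H] {ι : V →L[ℝ] H}
    (hι : Function.Injective ι) (hc : IsCompactOperator ι) {v : ℝ → V} {f : ℝ → H} {a b : ℝ}
    (hab : a ≤ b) (hv : MemLp v 2 (volume.restrict (Icc a b))) (hf : IntegrableOn f (Icc a b))
    (hcont : ContinuousOn (fun t => ι (v t)) (Icc a b))
    (heq : ∀ y : V, ∀ t ∈ Icc a b,
      ⟪ι (v t), ι y⟫ - ⟪ι (v a), ι y⟫ + ∫ r in a..t, ⟪v r, y⟫ = ∫ r in a..t, ⟪f r, ι y⟫) :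
    IntervalIntegrable (fun r => 2 * (-‖v r‖ ^ 2 + ⟪f r, ι (v r)⟫)) volume a b ∧
    ‖ι (v b)‖ ^ 2 - ‖ι (v a)‖ ^ 2 = ∫ r in a..b, 2 * (-‖v r‖ ^ 2 + ⟪f r, ι (v r)⟫) := by
  have := separableSpace_of_injective hι
  obtain ⟨I, e, μ, hμ, he⟩ := exists_hilbertBasis_singular hι hc
  have : Countable I := countable_of_orthonormal e.orthonormal
  obtain ⟨M, hM⟩ := isCompact_Icc.exists_bound_of_continuousOn hcont
  have hM0 : 0 ≤ M := (norm_nonneg _).trans (hM a (left_mem_Icc.2 hab))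
  have hIoc : uIoc a b ⊆ Icc a b := by rw [uIoc_of_le hab]; exact Ioc_subset_Icc_self
  have hvint : IntegrableOn v (Icc a b) := hv.integrable (by norm_num)
  have hv2 : IntegrableOn (fun r => ‖v r‖ ^ 2) (Icc a b) := hv.integrable_norm_pow (by norm_num)
  have ii : ∀ {g : ℝ → ℝ}, IntegrableOn g (Icc a b) → IntervalIntegrable g volume a b :=
    fun hg => (intervalIntegrable_iff_integrableOn_Icc_of_le hab).2 hg
  have hvi : ∀ y, IntervalIntegrable (fun r => ⟪v r, y⟫) volume a b :=
    fun y => ii (hvint.inner_const y)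
  have hfi : ∀ y, IntervalIntegrable (fun r => ⟪f r, y⟫) volume a b :=
    fun y => ii (hf.inner_const y)
  have hfw : IntegrableOn (fun r => ⟪f r, ι (v r)⟫) (Icc a b) := by
    refine (hf.norm.mul_const M).mono'
      (hf.1.inner (hcont.aestronglyMeasurable measurableSet_Icc)) ?_
    filter_upwards [ae_restrict_mem measurableSet_Icc] with r hr
    exact (abs_real_inner_le_norm _ _).trans (by gcongr; exact hM r hr)
  -- the equation for a single coordinate
  have hcoord : ∀ i, μ i * ⟪v b, e i⟫ ^ 2 - μ i * ⟪v a, e i⟫ ^ 2 =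
      ∫ r in a..b, 2 * (⟪v r, e i⟫ * (-⟪v r, e i⟫ + ⟪f r, ι (e i)⟫)) := by
    intro i
    have hD : IntervalIntegrable (fun r => -⟪v r, e i⟫ + ⟪f r, ι (e i)⟫) volume a b :=
      (hvi _).neg.add (hfi _)
    have hprim : ∀ t ∈ Icc a b, ⟪ι (v t), ι (e i)⟫ = ⟪ι (v a), ι (e i)⟫ +
        ∫ r in a..t, (-⟪v r, e i⟫ + ⟪f r, ι (e i)⟫) := by
      intro t ht
      have hsub : uIcc a t ⊆ uIcc a b := by
        rw [uIcc_of_le hab, uIcc_of_le ht.1]; exact Icc_subset_Icc_right ht.2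
      have h1 : IntervalIntegrable (fun r => -⟪v r, e i⟫) volume a t := (hvi _).neg.mono_set hsub
      rw [intervalIntegral.integral_add h1 ((hfi _).mono_set hsub),
        ← heq _ t ht, intervalIntegral.integral_neg]
      ring
    have key := integral_primitive_mul_primitive hab hD hD hprim hprim
    simp only [he] at key
    have hμi := (hμ i).ne'
    have : (∫ r in a..b, ((-⟪v r, e i⟫ + ⟪f r, ι (e i)⟫) * (μ i * ⟪v r, e i⟫) +
        μ i * ⟪v r, e i⟫ * (-⟪v r, e i⟫ + ⟪f r, ι (e i)⟫))) =
        μ i * ∫ r in a..b, 2 * (⟪v r, e i⟫ * (-⟪v r, e i⟫ + ⟪f r, ι (e i)⟫)) := by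
      rw [← intervalIntegral.integral_const_mul]
      congr 1; ext r; ring
    rw [this] at key
    apply mul_left_cancel₀ hμi
    rw [key]; ring
  -- summation
  have hsumH : ∀ x : V, HasSum (fun i => μ i * ⟪x, e i⟫ ^ 2) (‖ι x‖ ^ 2) := by
    intro x
    have h := e.hasSum_inner_mul_inner x (ContinuousLinearMap.adjoint ι (ι x))
    simp only [ContinuousLinearMap.adjoint_inner_right, real_inner_self_eq_norm_sq] at h
    have hfun : (fun i => μ i * ⟪x, e i⟫ ^ 2) = fun i => ⟪x, e i⟫ * ⟪ι (e i), ι x⟫ :=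
      funext fun i => by rw [real_inner_comm (ι x) (ι (e i)), he]; ring
    rw [hfun]
    exact h
  have hsumD : ∀ (x : V) (g : H),
      HasSum (fun i => ⟪x, e i⟫ * (-⟪x, e i⟫ + ⟪g, ι (e i)⟫)) (-‖x‖ ^ 2 + ⟪g, ι x⟫) := by
    intro x g
    have h1 := e.hasSum_inner_mul_inner x x
    have h2 := e.hasSum_inner_mul_inner x (ContinuousLinearMap.adjoint ι g)
    simp only [ContinuousLinearMap.adjoint_inner_right] at h2
    rw [real_inner_self_eq_norm_sq] at h1
    rw [real_inner_comm]
    have hfun : (fun i => ⟪x, e i⟫ * (-⟪x, e i⟫ + ⟪g, ι (e i)⟫)) =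
        fun i => -(⟪x, e i⟫ * ⟪e i, x⟫) + ⟪x, e i⟫ * ⟪ι (e i), g⟫ :=
      funext fun i => by rw [real_inner_comm x (e i), real_inner_comm g (ι (e i))]; ring
    rw [hfun]
    exact h1.neg.add h2
  -- This is the majorant for dominated convergence, uniform in `s`. The partial sum `p` is an
  -- orthogonal projection of `x` in `V`, and `ι p` is one of `ι x` in `H`, since the vectors `ι (e
  -- i)` are orthogonal too; hence neither norm increases.
  have hpart : ∀ (s : Finset I) (x : V) (g : H),
      |∑ i ∈ s, ⟪x, e i⟫ * (-⟪x, e i⟫ + ⟪g, ι (e i)⟫)| ≤ ‖x‖ ^ 2 + ‖g‖ * ‖ι x‖ := by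
    intro s x g
    set p := ∑ i ∈ s, ⟪x, e i⟫ • e i with hp
    have h1 : ∑ i ∈ s, ⟪x, e i⟫ * (-⟪x, e i⟫ + ⟪g, ι (e i)⟫) =
        -∑ i ∈ s, ⟪x, e i⟫ ^ 2 + ⟪g, ι p⟫ := by
      rw [hp, map_sum, inner_sum, ← Finset.sum_neg_distrib, ← Finset.sum_add_distrib]
      refine Finset.sum_congr rfl fun i _ => ?_
      rw [map_smul, inner_smul_right]; ring
    have h2 : ∑ i ∈ s, ⟪x, e i⟫ ^ 2 ≤ ‖x‖ ^ 2 := by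
      have := e.orthonormal.sum_inner_products_le x (s := s)
      simpa [real_inner_comm] using this
    have h3 : ⟪ι p, ι p⟫ = ⟪ι x, ι p⟫ := by
      have hz : ∀ z : V, ⟪ι z, ι p⟫ = ∑ i ∈ s, ⟪x, e i⟫ * (μ i * ⟪z, e i⟫) := fun z => by
        rw [hp, map_sum, inner_sum]
        exact Finset.sum_congr rfl fun i _ => by rw [map_smul, inner_smul_right, he]
      rw [hz, hz]
      refine Finset.sum_congr rfl fun i hi => ?_
      rw [real_inner_comm (e i) p, hp, e.orthonormal.inner_right_sum _ hi]
    have h4 : ‖ι p‖ ≤ ‖ι x‖ := by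
      have h5 := real_inner_le_norm (ι x) (ι p)
      rw [← h3, real_inner_self_eq_norm_sq] at h5
      rcases (norm_nonneg (ι p)).eq_or_lt with h | h
      · rw [← h]; exact norm_nonneg _
      · nlinarith
    have h5 : |⟪g, ι p⟫| ≤ ‖g‖ * ‖ι x‖ :=
      (abs_real_inner_le_norm _ _).trans (by gcongr)
    rw [h1]
    refine (abs_add_le _ _).trans (add_le_add ?_ h5)
    rw [abs_neg, abs_of_nonneg (Finset.sum_nonneg fun i _ => sq_nonneg _)]
    exact h2
  refine ⟨(ii (hv2.neg.add hfw)).const_mul 2, ?_⟩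
  have hL : Tendsto (fun s : Finset I =>
      ∑ i ∈ s, (μ i * ⟪v b, e i⟫ ^ 2 - μ i * ⟪v a, e i⟫ ^ 2)) atTop
      (𝓝 (‖ι (v b)‖ ^ 2 - ‖ι (v a)‖ ^ 2)) := (hsumH (v b)).sub (hsumH (v a))
  have hterm : ∀ i, IntervalIntegrable
      (fun r => 2 * (⟪v r, e i⟫ * (-⟪v r, e i⟫ + ⟪f r, ι (e i)⟫))) volume a b := by
    intro i
    have hci : ContinuousOn (fun r => ⟪v r, e i⟫) (uIcc a b) := by
      rw [uIcc_of_le hab]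
      -- Although `v` is only square integrable in `V`, each coordinate is continuous, being a
      -- multiple of an `H`-inner product with `ι (v r)`.
      have h1 : ContinuousOn (fun r => (μ i)⁻¹ * ⟪ι (v r), ι (e i)⟫) (Icc a b) :=
        (hcont.inner continuousOn_const).const_mul _
      refine h1.congr fun r _ => ?_
      simp only [he, inv_mul_cancel_left₀ (hμ i).ne']
    exact (((hvi _).neg.add (hfi _)).continuousOn_mul hci).const_mul 2
  have hR : Tendsto (fun s : Finset I =>
      ∫ r in a..b, ∑ i ∈ s, 2 * (⟪v r, e i⟫ * (-⟪v r, e i⟫ + ⟪f r, ι (e i)⟫))) atTop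
      (𝓝 (∫ r in a..b, 2 * (-‖v r‖ ^ 2 + ⟪f r, ι (v r)⟫))) := by
    refine intervalIntegral.tendsto_integral_filter_of_dominated_convergence
      (fun r => 2 * (‖v r‖ ^ 2 + ‖f r‖ * M)) (.of_forall fun s => ?_) (.of_forall fun s => ?_)
      ((ii (hv2.add (hf.norm.mul_const M))).const_mul 2) ?_
    · have := IntervalIntegrable.sum s (fun i _ => hterm i)
      exact this.aestronglyMeasurable_restrict_uIoc.congr (.of_forall fun r => by simp)
    · refine .of_forall fun r hr => ?_
      rw [← Finset.mul_sum, norm_mul, Real.norm_eq_abs, Real.norm_eq_abs, abs_two]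
      have h1 := hpart s (v r) (f r)
      have h2 := hM r (hIoc hr)
      have h3 := mul_le_mul_of_nonneg_left h2 (norm_nonneg (f r))
      linarith
    · exact .of_forall fun r _ => (hsumD (v r) (f r)).mul_left 2
  refine tendsto_nhds_unique hL (hR.congr fun s => ?_)
  rw [intervalIntegral.integral_finsetSum fun i _ => hterm i]
  exact Finset.sum_congr rfl fun i _ => (hcoord i).symm

end Embedding

/-! ### The mean ergodic theorem for a flow -/

section Ergodic

theorem abs_integral_orbit_le {Ω : Type*} {θ : ℝ → Ω → Ω} {f : Ω → ℝ} {M : ℝ}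
    (hM : ∀ ω, |f ω| ≤ M) (ω : Ω) (a b : ℝ) :
    |∫ r in a..b, f (θ r ω)| ≤ M * |b - a| := by
  rw [← Real.norm_eq_abs]
  exact intervalIntegral.norm_integral_le_of_norm_le_const fun r _ => hM _

variable {Ω : Type*} [MeasurableSpace Ω] {P : Measure Ω} {θ : ℝ → Ω → Ω}

namespace IsMetricDynamicalSystem

theorem measurable_apply (hθ : IsMetricDynamicalSystem P θ) (t : ℝ) : Measurable (θ t) :=
  hθ.measurable.comp measurable_prodMk_left

theorem measurable_orbit (hθ : IsMetricDynamicalSystem P θ) (ω : Ω) :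
    Measurable fun t => θ t ω :=
  hθ.measurable.comp measurable_prodMk_right

theorem apply_add (hθ : IsMetricDynamicalSystem P θ) (t s : ℝ) (ω : Ω) :
    θ (t + s) ω = θ t (θ s ω) :=
  congrFun (hθ.add t s) ω

theorem apply_zero (hθ : IsMetricDynamicalSystem P θ) (ω : Ω) : θ 0 ω = ω :=
  congrFun hθ.zero ω

/-- A property that holds almost surely holds, almost surely, at almost all times of an orbit. -/
theorem ae_ae_orbit [SFinite P] (hθ : IsMetricDynamicalSystem P θ) {p : Ω → Prop}
    (hp : ∀ᵐ ω ∂P, p ω) : ∀ᵐ ω ∂P, ∀ᵐ t : ℝ, p (θ t ω) := by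
  obtain ⟨s, hs, hsm, hs0⟩ := exists_measurable_superset_of_null hp
  have hm : MeasurableSet {q : ℝ × Ω | θ q.1 q.2 ∈ s} := hθ.measurable hsm
  have h1 : ∀ᵐ q ∂((volume : Measure ℝ).prod P), θ q.1 q.2 ∉ s := by
    refine (Measure.ae_prod_iff_ae_ae hm.compl).2 ?_
    exact .of_forall fun t =>
      (hθ.measurePreserving t).quasiMeasurePreserving.ae (measure_eq_zero_iff_ae_notMem.1 hs0)
  have h2 := Measure.ae_ae_of_ae_prod (Measure.measurePreserving_swap.quasiMeasurePreserving.ae h1)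
  filter_upwards [h2] with ω hω
  filter_upwards [hω] with t ht
  by_contra hcon
  exact ht (hs hcon)

/-- An almost invariant set is trivial. -/
theorem measure_eq_zero_or_one_of_ae_invariant [IsProbabilityMeasure P]
    (hθ : IsMetricDynamicalSystem P θ) {s : Set Ω} (hs : MeasurableSet s)
    (hinv : ∀ t, ∀ᵐ ω ∂P, θ t ω ∈ s ↔ ω ∈ s) : P s = 0 ∨ P s = 1 := by
  have hm : MeasurableSet {q : Ω × ℝ | θ q.2 q.1 ∈ s} :=
    (hθ.measurable.comp measurable_swap) hs
  -- Ergodicity concerns strictly invariant sets. The set of `ω` whose orbit lies in `s` at almost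
  -- every time is strictly invariant, because Lebesgue null sets are translation invariant, and by
  -- Fubini it equals `s` up to a null set.
  set s' : Set Ω := {ω | ∀ᵐ t : ℝ, θ t ω ∈ s} with hs'
  have hs'm : MeasurableSet s' := by
    have h1 : Measurable fun ω => volume {t : ℝ | θ t ω ∉ s} :=
      measurable_measure_prodMk_left hm.compl
    exact h1 (measurableSet_singleton 0)
  have hs'inv : ∀ t, θ t ⁻¹' s' = s' := by
    intro τ
    ext ω
    simp only [hs', mem_preimage, mem_ofPred_eq, ← hθ.apply_add]
    have hq : Measure.QuasiMeasurePreserving (fun t : ℝ => t + τ) volume volume :=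
      (measurePreserving_add_right volume τ).quasiMeasurePreserving
    have hq' : Measure.QuasiMeasurePreserving (fun t : ℝ => t + -τ) volume volume :=
      (measurePreserving_add_right volume (-τ)).quasiMeasurePreserving
    refine ⟨fun h => ?_, fun h => hq.ae h⟩
    filter_upwards [hq'.ae h] with t ht
    simpa using ht
  have hae : s' =ᵐ[P] s := by
    have h1 : ∀ᵐ q ∂((volume : Measure ℝ).prod P), (θ q.1 q.2 ∈ s ↔ q.2 ∈ s) := by
      rw [Measure.ae_prod_iff_ae_ae]
      · exact .of_forall hinv
      · exact (hθ.measurable hs).iff (measurable_snd hs)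
    have h2 := Measure.ae_ae_of_ae_prod
      (Measure.measurePreserving_swap.quasiMeasurePreserving.ae h1)
    filter_upwards [h2] with ω hω
    refine propext ⟨fun h => ?_, fun h => ?_⟩
    · obtain ⟨t, h3, h4⟩ := (Filter.Eventually.and hω (show ∀ᵐ t : ℝ, θ t ω ∈ s from h)).exists
      exact h3.1 h4
    · change ∀ᵐ t : ℝ, θ t ω ∈ s
      filter_upwards [hω] with t ht using ht.2 h
  rw [← measure_congr hae]
  exact hθ.ergodic s' hs'm hs'inv

/-- An almost invariant function is almost surely constant. -/
theorem exists_ae_eq_const_of_ae_invariant [IsProbabilityMeasure P]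
    (hθ : IsMetricDynamicalSystem P θ) {g : Ω → ℝ} (hg : AEMeasurable g P)
    (hinv : ∀ t, g ∘ θ t =ᵐ[P] g) : ∃ C, g =ᵐ[P] fun _ => C := by
  have hinv' : ∀ t, hg.mk g ∘ θ t =ᵐ[P] hg.mk g := fun t =>
    ((hθ.measurePreserving t).quasiMeasurePreserving.ae_eq_comp hg.ae_eq_mk.symm).trans
      ((hinv t).trans hg.ae_eq_mk)
  -- All preimages of measurable sets have probability zero or one, and countably many measurable
  -- sets separate the points of `ℝ`.
  obtain ⟨C, hC⟩ := exists_eventuallyEq_const_of_forall_separating (l := ae P) (f := hg.mk g)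
    MeasurableSet (fun U hU => by
      have hm : MeasurableSet (hg.mk g ⁻¹' U) := hg.measurable_mk hU
      rcases hθ.measure_eq_zero_or_one_of_ae_invariant hm (fun t => by
        filter_upwards [hinv' t] with ω hω
        simp only [Function.comp_apply] at hω
        simp [hω]) with h | h
      · exact Or.inr (measure_eq_zero_iff_ae_notMem.1 h)
      · exact Or.inl ((prob_compl_eq_zero_iff hm).2 h))
  exact ⟨C, hg.ae_eq_mk.trans hC⟩

theorem integral_orbit_shift (hθ : IsMetricDynamicalSystem P θ) (f : Ω → ℝ) (ω : Ω)
    (a b t : ℝ) : ∫ r in a..b, f (θ r (θ t ω)) = ∫ r in (a + t)..(b + t), f (θ r ω) := by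
  rw [← intervalIntegral.integral_comp_add_right (fun r => f (θ r ω))]
  simp only [hθ.apply_add]

theorem measurable_integral_orbit (hθ : IsMetricDynamicalSystem P θ) {f : Ω → ℝ}
    (hf : Measurable f) (a b : ℝ) : Measurable fun ω => ∫ r in a..b, f (θ r ω) := by
  have h : StronglyMeasurable (Function.uncurry fun (ω : Ω) (r : ℝ) => f (θ r ω)) :=
    (hf.comp (hθ.measurable.comp measurable_swap)).stronglyMeasurable
  simp only [intervalIntegral]
  exact (h.integral_prod_right.measurable).sub h.integral_prod_right.measurable

theorem intervalIntegrable_orbit (hθ : IsMetricDynamicalSystem P θ) {f : Ω → ℝ}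
    (hf : Measurable f) {M : ℝ} (hM : ∀ ω, |f ω| ≤ M) (ω : Ω) (a b : ℝ) :
    IntervalIntegrable (fun r => f (θ r ω)) volume a b := by
  refine (intervalIntegrable_const (c := M)).mono_fun'
    (hf.comp (hθ.measurable_orbit ω)).aestronglyMeasurable ?_
  exact .of_forall fun r => hM _

theorem integral_integral_orbit [IsProbabilityMeasure P] (hθ : IsMetricDynamicalSystem P θ)
    {f : Ω → ℝ} (hf : Measurable f) {M : ℝ} (hM : ∀ ω, |f ω| ≤ M) (a b : ℝ) :
    ∫ ω, (∫ r in a..b, f (θ r ω)) ∂P = (b - a) * ∫ ω, f ω ∂P := by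
  have : IsFiniteMeasure (volume.restrict (uIoc a b)) :=
    ⟨by rw [Measure.restrict_apply_univ]; simp [uIoc]⟩
  have hint : Integrable (Function.uncurry fun (r : ℝ) (ω : Ω) => f (θ r ω))
      ((volume.restrict (uIoc a b)).prod P) :=
    .of_bound (hf.comp hθ.measurable).aestronglyMeasurable M (.of_forall fun q => hM _)
  rw [← intervalIntegral_integral_swap hint]
  have h : ∀ r, ∫ ω, f (θ r ω) ∂P = ∫ ω, f ω ∂P := fun r => by
    conv_rhs => rw [← (hθ.measurePreserving r).map_eq]
    exact (integral_map (hθ.measurable_apply r).aemeasurable hf.aestronglyMeasurable).symm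
  simp [h]

/-- The mean ergodic theorem for time averages of a bounded function over `[0, n]`. -/
theorem tendsto_eLpNorm_average [IsProbabilityMeasure P] (hθ : IsMetricDynamicalSystem P θ)
    {f : Ω → ℝ} (hf : Measurable f) {M : ℝ} (hM : ∀ ω, |f ω| ≤ M) :
    Tendsto (fun n : ℕ => eLpNorm
      (fun ω => (n : ℝ)⁻¹ * (∫ r in 0..(n : ℝ), f (θ r ω)) - ∫ ω, f ω ∂P) 2 P) atTop (𝓝 0) := by
  have hM0 : 0 ≤ M := by
    obtain ⟨ω⟩ := P.nonempty_of_neZero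
    exact (abs_nonneg _).trans (hM ω)
  set J : ℝ → ℝ → Ω → ℝ := fun a b ω => ∫ r in a..b, f (θ r ω) with hJ
  have hJL : ∀ a b, MemLp (J a b) 2 P := fun a b =>
    .of_bound (hθ.measurable_integral_orbit hf a b).aestronglyMeasurable (M * |b - a|)
      (.of_forall fun ω => abs_integral_orbit_le hM ω a b)
  have hii := hθ.intervalIntegrable_orbit hf hM
  set U : ℝ → Lp ℝ 2 P →L[ℝ] Lp ℝ 2 P := fun t =>
    (Lp.compMeasurePreservingₗᵢ ℝ (θ t) (hθ.measurePreserving t)).toContinuousLinearMap with hU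
  have hUJ : ∀ t a b, U t (hJL a b).toLp = (hJL (a + t) (b + t)).toLp := by
    intro t a b
    have h1 : U t (hJL a b).toLp =
        Lp.compMeasurePreserving (θ t) (hθ.measurePreserving t) (hJL a b).toLp := rfl
    rw [h1, Lp.toLp_compMeasurePreserving, MemLp.toLp_eq_toLp_iff]
    exact .of_forall fun ω => hθ.integral_orbit_shift f ω a b t
  have hiter : ∀ n : ℕ, (U 1)^[n] (hJL 0 1).toLp = (hJL n (n + 1)).toLp := by
    intro n
    induction n with
    | zero =>
      simp only [Function.iterate_zero, id_eq, MemLp.toLp_eq_toLp_iff]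
      simp
    | succ n ih =>
      rw [Function.iterate_succ_apply', ih, hUJ, MemLp.toLp_eq_toLp_iff]
      simp
  have hsum : ∀ n : ℕ, birkhoffSum (U 1) id n (hJL 0 1).toLp = (hJL 0 n).toLp := by
    intro n
    induction n with
    | zero =>
      rw [birkhoffSum_zero, eq_comm, ← MemLp.toLp_zero (MemLp.zero' (ε := ℝ)),
        MemLp.toLp_eq_toLp_iff]
      exact .of_forall fun ω => by simp [hJ]
    | succ n ih =>
      rw [birkhoffSum_succ, ih, id_eq, hiter, ← MemLp.toLp_add, MemLp.toLp_eq_toLp_iff]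
      refine .of_forall fun ω => ?_
      simp only [hJ, Pi.add_apply, Nat.cast_add, Nat.cast_one]
      exact intervalIntegral.integral_add_adjacent_intervals (hii ω _ _) (hii ω _ _)
  -- Von Neumann's theorem for the time-one map, applied to the integral over a unit of time. That
  -- map need not be ergodic, so the limit is so far only a `U 1`-invariant function.
  have hconv := (U 1).tendsto_birkhoffAverage_orthogonalProjection
    (LinearIsometry.norm_toContinuousLinearMap_le _) (hJL 0 1).toLp
  set G : Lp ℝ 2 P := (((U 1).eqLocus
    (1 : Lp ℝ 2 P →L[ℝ] Lp ℝ 2 P)).orthogonalProjectionOnto (hJL 0 1).toLp : Lp ℝ 2 P) with hG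
  have hconv' : Tendsto (fun n : ℕ => (n : ℝ)⁻¹ • (hJL 0 n).toLp) atTop (𝓝 G) := by
    simpa only [birkhoffAverage, hsum] using hconv
  -- the limit is invariant under the flow
  have hinv : ∀ t, U t G = G := by
    intro t
    have h1 := ((U t).continuous.tendsto G).comp hconv'
    have h2 : Tendsto (fun n : ℕ => (n : ℝ)⁻¹ • (hJL (0 + t) (n + t)).toLp) atTop (𝓝 (U t G)) :=
      h1.congr fun n => by simp only [Function.comp_apply, map_smul, hUJ]
    -- The integrals over `[t, n + t]` and `[0, n]` differ by two end pieces of length `|t|`, which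
    -- is negligible after division by `n`.
    have h3 : Tendsto (fun n : ℕ => (n : ℝ)⁻¹ * (2 * (M * |t|))) atTop (𝓝 0) := by
      simpa using (tendsto_inv_atTop_nhds_zero_nat (𝕜 := ℝ)).mul_const (2 * (M * |t|))
    have h4 : Tendsto (fun n : ℕ => (n : ℝ)⁻¹ • (hJL (0 + t) (n + t)).toLp -
        (n : ℝ)⁻¹ • (hJL 0 n).toLp) atTop (𝓝 0) := by
      refine squeeze_zero_norm (fun n => ?_) h3
      rw [← smul_sub, norm_smul, norm_inv, Real.norm_natCast, ← MemLp.toLp_sub]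
      refine mul_le_mul_of_nonneg_left ?_ (by positivity)
      have h5 := Lp.norm_le_of_ae_bound (p := 2) (μ := P) (C := 2 * (M * |t|))
        (f := ((hJL (0 + t) (n + t)).sub (hJL 0 n)).toLp) (by positivity) ?_
      · simpa [measureUnivNNReal] using h5
      · filter_upwards [((hJL (0 + t) (n + t)).sub (hJL 0 n)).coeFn_toLp] with ω hω
        rw [hω]
        have e1 := intervalIntegral.integral_interval_sub_interval_comm
          (hii ω (0 + t) (n + t)) (hii ω 0 n) (hii ω (0 + t) 0)
        simp only [hJ, Pi.sub_apply]
        rw [e1, Real.norm_eq_abs]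
        refine (abs_sub _ _).trans ?_
        have e2 := abs_integral_orbit_le (θ := θ) hM ω (0 + t) 0
        have e3 := abs_integral_orbit_le (θ := θ) hM ω (n + t) n
        simp only [zero_add, zero_sub, abs_neg, sub_add_cancel_left] at e2 e3 ⊢
        linarith
    have h5 := h2.sub hconv'
    exact sub_eq_zero.1 (tendsto_nhds_unique h5 h4)
  obtain ⟨C, hC⟩ := hθ.exists_ae_eq_const_of_ae_invariant (Lp.aestronglyMeasurable G).aemeasurable
    (fun t => by
      have h1 := Lp.coeFn_compMeasurePreserving G (hθ.measurePreserving t)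
      have h2 : Lp.compMeasurePreserving (θ t) (hθ.measurePreserving t) G = G := hinv t
      rw [h2] at h1
      exact h1.symm)
  have hlim : Tendsto (fun n : ℕ => eLpNorm (fun ω => (n : ℝ)⁻¹ * J 0 n ω - C) 2 P) atTop
      (𝓝 0) := by
    rw [Lp.tendsto_Lp_iff_tendsto_eLpNorm'] at hconv'
    refine hconv'.congr fun n => eLpNorm_congr_ae ?_
    filter_upwards [hC, Lp.coeFn_smul (n : ℝ)⁻¹ (hJL 0 n).toLp, (hJL 0 n).coeFn_toLp]
      with ω h1 h2 h3
    rw [Pi.sub_apply, h1, h2, Pi.smul_apply, h3, smul_eq_mul]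
  -- identification of the limit
  have hCf : C = ∫ ω, f ω ∂P := by
    have h1 : Tendsto (fun n : ℕ => ∫ ω, (n : ℝ)⁻¹ * J 0 n ω ∂P) atTop (𝓝 (∫ _, C ∂P)) := by
      refine tendsto_integral_of_L1' _ aestronglyMeasurable_const
        (.of_forall fun n => ((hJL 0 n).integrable (by norm_num)).const_mul _) ?_
      refine tendsto_of_tendsto_of_tendsto_of_le_of_le tendsto_const_nhds hlim
        (fun _ => zero_le) fun n => ?_
      exact eLpNorm_le_eLpNorm_of_exponent_le (by norm_num)
        ((((hJL 0 n).1.const_mul _)).sub aestronglyMeasurable_const)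
    have h2 : ∀ᶠ n : ℕ in atTop, ∫ ω, f ω ∂P = ∫ ω, (n : ℝ)⁻¹ * J 0 n ω ∂P := by
      filter_upwards [eventually_ne_atTop 0] with n hn
      rw [integral_const_mul, hJ, hθ.integral_integral_orbit hf hM, sub_zero,
        inv_mul_cancel_left₀ (Nat.cast_ne_zero.2 hn)]
    have h3 := tendsto_nhds_unique h1 (tendsto_const_nhds.congr' h2)
    simpa using h3
  rw [← hCf]
  exact hlim

/-! ### Time averages of unbounded nonnegative observables -/

theorem lintegral_lintegral_orbit [SFinite P] (hθ : IsMetricDynamicalSystem P θ) {f : Ω → ℝ≥0∞}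
    (hf : Measurable f) (s : Set ℝ) :
    ∫⁻ ω, (∫⁻ r in s, f (θ r ω)) ∂P = volume s * ∫⁻ ω, f ω ∂P := by
  rw [lintegral_lintegral_swap]
  · simp only [(hθ.measurePreserving _).lintegral_comp hf, lintegral_const,
      Measure.restrict_apply_univ]
    rw [mul_comm]
  · exact (hf.comp (hθ.measurable.comp measurable_swap)).aemeasurable

theorem measurable_lintegral_orbit (hθ : IsMetricDynamicalSystem P θ) {f : Ω → ℝ≥0∞}
    (hf : Measurable f) (s : Set ℝ) : Measurable fun ω => ∫⁻ r in s, f (θ r ω) :=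
  Measurable.lintegral_prod_right' (f := fun q : Ω × ℝ => f (θ q.2 q.1))
    (hf.comp (hθ.measurable.comp measurable_swap))

/-- If `E f < κ`, then the time averages of `f ≥ 0` exceed `κ` with vanishing probability. -/
theorem tendsto_measure_le_lintegral_orbit [IsProbabilityMeasure P]
    (hθ : IsMetricDynamicalSystem P θ) {f : Ω → ℝ≥0∞} (hf : Measurable f) {κ : ℝ}
    (hκ : ∫⁻ ω, f ω ∂P < ENNReal.ofReal κ) :
    Tendsto (fun n : ℕ => P {ω | ENNReal.ofReal (n * κ) ≤ ∫⁻ r in Icc 0 (n : ℝ), f (θ r ω)})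
      atTop (𝓝 0) := by
  have hfin : ∫⁻ ω, f ω ∂P ≠ ∞ := hκ.ne_top
  set e := (∫⁻ ω, f ω ∂P).toReal with he
  have hκ0 : 0 < κ := ENNReal.ofReal_pos.1 (zero_le.trans_lt hκ)
  have hek : e < κ := (ENNReal.lt_ofReal_iff_toReal_lt hfin).1 hκ
  -- The gap `κ - e` is split in two: one half absorbs the fluctuation of the truncated average
  -- about its mean, the other the contribution of the truncated tail.
  set d := (κ - e) / 2 with hd
  have hd0 : 0 < d := by rw [hd]; linarith
  set g : ℕ → Ω → ℝ≥0∞ := fun N ω => min (f ω) N with hg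
  have hgm : ∀ N, Measurable (g N) := fun N => hf.min measurable_const
  have hgf : ∀ N ω, g N ω ≤ f ω := fun N ω => min_le_left _ _
  have hgfin : ∀ N, ∫⁻ ω, g N ω ∂P ≠ ∞ := fun N =>
    ne_top_of_le_ne_top hfin (lintegral_mono (hgf N))
  have hlim : Tendsto (fun N => ∫⁻ ω, (f ω - g N ω) ∂P) atTop (𝓝 0) := by
    have h1 : Tendsto (fun N => ∫⁻ ω, g N ω ∂P) atTop (𝓝 (∫⁻ ω, f ω ∂P)) := by
      refine lintegral_tendsto_of_tendsto_of_monotone (fun N => (hgm N).aemeasurable)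
        (.of_forall fun ω m n hmn => min_le_min_left _ (Nat.cast_le.2 hmn))
        (.of_forall fun ω => ?_)
      have := (tendsto_const_nhds (x := f ω)).min ENNReal.tendsto_nat_nhds_top
      simpa using this
    have h2 := ENNReal.Tendsto.sub (tendsto_const_nhds (x := ∫⁻ ω, f ω ∂P)) h1 (Or.inl hfin)
    rw [tsub_self] at h2
    exact h2.congr fun N => (lintegral_sub (hgm N) (hgfin N) (.of_forall (hgf N))).symm
  rw [ENNReal.tendsto_nhds_zero]
  intro ε hε
  have hε2 : 0 < ε / 2 := ENNReal.half_pos hε.ne'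
  have hεd : 0 < ε / 2 * ENNReal.ofReal d := ENNReal.mul_pos hε2.ne' (by simpa using hd0)
  obtain ⟨N, hN⟩ := ((ENNReal.tendsto_nhds_zero.1 hlim) _ hεd).exists
  set G : Ω → ℝ := fun ω => (g N ω).toReal with hG
  have hgN : ∀ ω, g N ω ≠ ∞ := fun ω =>
    ne_top_of_le_ne_top (ENNReal.natCast_ne_top N) (min_le_right _ _)
  have hGm : Measurable G := (hgm N).ennreal_toReal
  have hGb : ∀ ω, |G ω| ≤ N := fun ω => by
    rw [abs_of_nonneg ENNReal.toReal_nonneg]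
    exact ENNReal.toReal_le_of_le_ofReal (Nat.cast_nonneg N) (by simp [hg])
  have hGe : ∫ ω, G ω ∂P ≤ e := by
    rw [hG, integral_toReal (hgm N).aemeasurable (.of_forall fun ω => (hgN ω).lt_top)]
    exact ENNReal.toReal_mono hfin (lintegral_mono (hgf N))
  have hmeas : TendstoInMeasure P
      (fun (n : ℕ) ω => (n : ℝ)⁻¹ * ∫ r in 0..(n : ℝ), G (θ r ω)) atTop
      (fun _ => ∫ ω, G ω ∂P) := tendstoInMeasure_of_tendsto_eLpNorm (p := 2) (by norm_num)
    (fun n => ((hθ.measurable_integral_orbit hGm 0 (n : ℝ)).const_mul _).aestronglyMeasurable)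
    aestronglyMeasurable_const (hθ.tendsto_eLpNorm_average hGm hGb)
  rw [tendstoInMeasure_iff_dist] at hmeas
  filter_upwards [(ENNReal.tendsto_nhds_zero.1 (hmeas d hd0)) _ hε2, eventually_ne_atTop 0]
    with n hn hn0
  have hnpos : (0 : ℝ) < n := by positivity
  -- The tail needs no ergodicity: by invariance of `P` its integral over `[0, n]` has mean `n`
  -- times the small number `∫ (f - g N)`, and Markov's inequality gives a bound independent of `n`.
  set S : Set Ω := {ω | ENNReal.ofReal (d * n) ≤ ∫⁻ r in Icc 0 (n : ℝ), (f (θ r ω) - g N (θ r ω))}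
    with hS
  have hSle : P S ≤ ε / 2 := by
    have hm := hθ.measurable_lintegral_orbit (hf.sub (hgm N)) (Icc 0 (n : ℝ))
    have hdn : ENNReal.ofReal (d * n) ≠ 0 := by simpa using mul_pos hd0 hnpos
    refine (meas_ge_le_lintegral_div hm.aemeasurable hdn ENNReal.ofReal_ne_top).trans ?_
    rw [ENNReal.div_le_iff hdn ENNReal.ofReal_ne_top]
    have := hθ.lintegral_lintegral_orbit (hf.sub (hgm N)) (Icc 0 (n : ℝ))
    simp only [Pi.sub_apply] at this ⊢
    rw [this, Real.volume_Icc, sub_zero, ENNReal.ofReal_mul hd0.le, ← mul_assoc, mul_comm]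
    exact mul_le_mul_left hN _
  refine (measure_mono (t := S ∪ _) ?_).trans ((measure_union_le _ _).trans
    ((add_le_add hSle hn).trans_eq (ENNReal.add_halves ε)))
  intro ω hω
  by_contra hcon
  simp only [mem_union, not_or, hS, mem_ofPred_eq, not_le] at hcon hω
  obtain ⟨h1, h2⟩ := hcon
  have h3 : ∫⁻ r in Icc 0 (n : ℝ), g N (θ r ω) =
      ENNReal.ofReal (∫ r in 0..(n : ℝ), G (θ r ω)) := by
    rw [intervalIntegral.integral_of_le hnpos.le, ← integral_Icc_eq_integral_Ioc,
      ofReal_integral_eq_lintegral_ofReal]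
    · simp only [hG, ENNReal.ofReal_toReal (hgN _)]
    · exact (intervalIntegrable_iff_integrableOn_Icc_of_le hnpos.le).1
        (hθ.intervalIntegrable_orbit hGm hGb ω 0 n)
    · exact .of_forall fun r => ENNReal.toReal_nonneg
  have h4 : ∫ r in 0..(n : ℝ), G (θ r ω) < (e + d) * n := by
    rw [Real.dist_eq] at h2
    have h5 := (abs_lt.1 h2).2
    have h6 : (n : ℝ)⁻¹ * ∫ r in 0..(n : ℝ), G (θ r ω) < e + d := by linarith
    rwa [inv_mul_lt_iff₀ hnpos, mul_comm] at h6
  have h7 : ∫⁻ r in Icc 0 (n : ℝ), f (θ r ω) = (∫⁻ r in Icc 0 (n : ℝ), g N (θ r ω)) +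
      ∫⁻ r in Icc 0 (n : ℝ), (f (θ r ω) - g N (θ r ω)) := by
    have hgo : Measurable fun r => g N (θ r ω) := (hgm N).comp (hθ.measurable_orbit ω)
    rw [← lintegral_add_left hgo]
    exact lintegral_congr fun r => (add_tsub_cancel_of_le (hgf N _)).symm
  rw [h7, h3] at hω
  have h0 : 0 ≤ e := ENNReal.toReal_nonneg
  have h8 : ENNReal.ofReal (∫ r in 0..(n : ℝ), G (θ r ω)) +
      ∫⁻ r in Icc 0 (n : ℝ), (f (θ r ω) - g N (θ r ω)) <
      ENNReal.ofReal ((e + d) * n) + ENNReal.ofReal (d * n) :=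
    ENNReal.add_lt_add ((ENNReal.ofReal_lt_ofReal_iff (by positivity)).2 h4) h1
  rw [← ENNReal.ofReal_add (by positivity) (by positivity)] at h8
  have h9 : (e + d) * n + d * n = n * κ := by rw [hd]; ring
  rw [h9] at h8
  exact (h8.trans_le hω).false

end IsMetricDynamicalSystem
end Ergodic

/-! ### Trajectories in the absorbing set -/

section Trajectories

theorem lintegral_Icc_add_right {f : ℝ → ℝ≥0∞} (hf : Measurable f) (a b t : ℝ) :
    ∫⁻ s in Icc a b, f (s + t) = ∫⁻ r in Icc (a + t) (b + t), f r := by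
  have hmp := (measurePreserving_add_right volume t).restrict_preimage
    (measurableSet_Icc (a := a + t) (b := b + t))
  have hpre : (fun s => s + t) ⁻¹' Icc (a + t) (b + t) = Icc a b := by
    ext s; simp
  rw [hpre] at hmp
  exact hmp.lintegral_comp hf

/-- By Tonelli, the windows `[s, s + m]` with `s ∈ [0, n]` cover each point of `[m, n]` for a set of
`s` of length `m`. Only `[0, m]` may be covered less, and it is added separately. This carries a
bound on windows of length `m` over to long intervals whose length need not be a multiple of `m`. -/
theorem lintegral_Icc_le_add_windows {f : ℝ → ℝ≥0∞} (hf : Measurable f) {m : ℝ} (hm : 0 < m)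
    (n : ℝ) :
    ∫⁻ r in Icc 0 n, f r ≤ (∫⁻ r in Icc 0 m, f r) +
      (ENNReal.ofReal m)⁻¹ * ∫⁻ s in Icc 0 n, ∫⁻ t in Icc 0 m, f (s + t) := by
  have hm0 : ENNReal.ofReal m ≠ 0 := by simpa using hm
  have h1 : ENNReal.ofReal m * ∫⁻ r in Icc m n, f r ≤
      ∫⁻ s in Icc 0 n, ∫⁻ t in Icc 0 m, f (s + t) := by
    rw [lintegral_lintegral_swap (f := fun s t => f (s + t)) (hf.comp measurable_add).aemeasurable]
    have h2 : ∫⁻ t in Icc 0 m, (∫⁻ r in Icc m n, f r) =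
        ENNReal.ofReal m * ∫⁻ r in Icc m n, f r := by
      rw [lintegral_const, Measure.restrict_apply_univ, Real.volume_Icc, sub_zero, mul_comm]
    rw [← h2]
    -- For fixed `t ∈ [0, m]`, the shifted interval `[t, n + t]` contains `[m, n]`.
    refine setLIntegral_mono' measurableSet_Icc fun t ht => ?_
    rw [lintegral_Icc_add_right hf]
    exact lintegral_mono_set (Icc_subset_Icc (by linarith [ht.2]) (by linarith [ht.1]))
  have h2 : ∫⁻ r in Icc m n, f r ≤
      (ENNReal.ofReal m)⁻¹ * ∫⁻ s in Icc 0 n, ∫⁻ t in Icc 0 m, f (s + t) := by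
    rw [← ENNReal.div_eq_inv_mul,
      ENNReal.le_div_iff_mul_le (Or.inl hm0) (Or.inl ENNReal.ofReal_ne_top), mul_comm]
    exact h1
  refine le_trans ?_ (add_le_add_right h2 _)
  refine (lintegral_mono_set (t := Icc 0 m ∪ Icc m n) fun r hr => ?_).trans
    (lintegral_union_le _ _ _)
  rcases le_total r m with h | h
  · exact Or.inl ⟨hr.1, h⟩
  · exact Or.inr ⟨h, hr.2⟩

section

variable {V H : Type*} [NormedAddCommGroup V] [InnerProductSpace ℝ V]
  [NormedAddCommGroup H] [InnerProductSpace ℝ H] {ι : V →L[ℝ] H}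

theorem toV_sub (hι : Function.Injective ι) {x y : H} (hx : x ∈ range ι) (hy : y ∈ range ι) :
    toV ι (x - y) = toV ι x - toV ι y := by
  obtain ⟨v, rfl⟩ := hx
  obtain ⟨w, rfl⟩ := hy
  rw [← map_sub, toV_apply hι, toV_apply hι, toV_apply hι]

theorem ι_toV (hι : Function.Injective ι) {x : H} (hx : x ∈ range ι) : ι (toV ι x) = x := by
  obtain ⟨v, rfl⟩ := hx
  rw [toV_apply hι]

theorem aestronglyMeasurable_iSup_functionals [MeasurableSpace V] [BorelSpace V] {k : ℕ}
    (L : Fin k → StrongDual ℝ V) {v : ℝ → V} {μ : Measure ℝ} (hv : AEStronglyMeasurable v μ) :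
    AEStronglyMeasurable (fun t => ⨆ j, |L j (v t)| ^ 2) μ := by
  have h : Measurable fun x : V => ⨆ j, |L j x| ^ 2 :=
    .iSup fun j => ((L j).continuous.measurable.abs.pow_const 2)
  exact (h.comp_aemeasurable hv.aemeasurable).aestronglyMeasurable

theorem iSup_functionals_le {k : ℕ} (L : Fin k → StrongDual ℝ V) (x : V) :
    ⨆ j, |L j x| ^ 2 ≤ (∑ j, ‖L j‖ ^ 2) * ‖x‖ ^ 2 := by
  refine Real.iSup_le (fun j => ?_) (by positivity)
  calc |L j x| ^ 2 ≤ (‖L j‖ * ‖x‖) ^ 2 := by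
        gcongr; exact (L j).le_opNorm x
    _ = ‖L j‖ ^ 2 * ‖x‖ ^ 2 := mul_pow _ _ _
    _ ≤ _ := by
        gcongr
        exact Finset.single_le_sum (f := fun j => ‖L j‖ ^ 2) (fun i _ => by positivity)
          (Finset.mem_univ j)

/-- The map `toV` respects differences only on the range of `ι`. Solutions lie there at almost every
positive time, so the integrand agrees almost everywhere with one bounded by a multiple of the
square of an `L²` function. -/
theorem intervalIntegrable_functionals [CompleteSpace H] [MeasurableSpace V] [BorelSpace V]
    {Ω : Type*} {θ : ℝ → Ω → Ω} {F : V → Ω → H} (hι : Function.Injective ι) {ω : Ω}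
    {x₁ x₂ : H} {u₁ u₂ : ℝ → H} (hu₁ : IsWeakSolution ι F θ ω x₁ u₁)
    (hu₂ : IsWeakSolution ι F θ ω x₂ u₂) {k : ℕ} (L : Fin k → StrongDual ℝ V) {a b : ℝ}
    (ha : 0 < a) (hab : a ≤ b) :
    IntervalIntegrable (fun t => ⨆ j, |L j (toV ι (u₁ t - u₂ t))| ^ 2) volume a b := by
  rw [intervalIntegrable_iff_integrableOn_Icc_of_le hab]
  have hv : MemLp (fun t => toV ι (u₁ t) - toV ι (u₂ t)) 2 (volume.restrict (Icc a b)) :=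
    (hu₁.memLp a b ha).sub (hu₂.memLp a b ha)
  have hI : IntegrableOn (fun t => ⨆ j, |L j (toV ι (u₁ t) - toV ι (u₂ t))| ^ 2) (Icc a b) := by
    refine ((hv.integrable_norm_pow (by norm_num)).const_mul (∑ j, ‖L j‖ ^ 2)).mono'
      (aestronglyMeasurable_iSup_functionals L hv.1) (.of_forall fun t => ?_)
    rw [Real.norm_of_nonneg (Real.iSup_nonneg fun j => by positivity)]
    exact iSup_functionals_le L _
  refine hI.congr ?_
  have hsub : Icc a b ⊆ Ioi 0 := fun t ht => ha.trans_le ht.1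
  filter_upwards [ae_restrict_of_ae_restrict_of_subset hsub hu₁.mem_V,
    ae_restrict_of_ae_restrict_of_subset hsub hu₂.mem_V] with t h1 h2
  rw [toV_sub hι h1 h2]

theorem energyOp_apply (u y : V) : energyOp u y = ⟪u, y⟫ := rfl

theorem toDual_apply (h : H) (y : V) : toDual ι h y = ⟪h, ι y⟫ := rfl

/-- The distance of two solutions that stay in the sets on which the dissipativity estimate
holds. -/
theorem norm_sub_sq_le_of_dissipative [CompleteSpace V] [CompleteSpace H]
    [TopologicalSpace.SeparableSpace H] [MeasurableSpace V] [BorelSpace V]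
    {Ω : Type*} {θ : ℝ → Ω → Ω} {B : Ω → Set V} {F : V → Ω → H} (hι : Function.Injective ι)
    (hc : IsCompactOperator ι) {ω : Ω} {x₁ x₂ : H} {u₁ u₂ : ℝ → H}
    (hu₁ : IsWeakSolution ι F θ ω x₁ u₁) (hu₂ : IsWeakSolution ι F θ ω x₂ u₂)
    {k : ℕ} (L : Fin k → StrongDual ℝ V) {l : V → V → Ω → ℝ} (hl0 : ∀ x₁ x₂ ω, 0 ≤ l x₁ x₂ ω)
    {a b c κ C Λ : ℝ} (ha : 0 < a) (hab : a ≤ b) (hκ : 0 ≤ κ) (hC : 0 ≤ C) (hΛ : 0 ≤ Λ)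
    (hLC : ∀ v : V, κ * ‖ι v‖ ^ 2 ≤ c * ‖v‖ ^ 2 + C * ⨆ j, |L j v| ^ 2)
    (hmono : ∀ ω, ∀ x₁ ∈ B ω, ∀ x₂ ∈ B ω,
      (-energyOp (x₁ - x₂) + toDual ι (F x₁ ω - F x₂ ω)) (x₁ - x₂)
        ≤ -c * ‖x₁ - x₂‖ ^ 2 + l x₁ x₂ ω * ‖ι (x₁ - x₂)‖ ^ 2)
    (hmem₁ : ∀ t ∈ Icc a b, u₁ t ∈ ι '' B (θ t ω))
    (hmem₂ : ∀ t ∈ Icc a b, u₂ t ∈ ι '' B (θ t ω))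
    (hl : Measurable fun t : ℝ => l (toV ι (u₁ t)) (toV ι (u₂ t)) (θ t ω))
    (hlΛ : ∫⁻ t in Icc a b, ENNReal.ofReal (l (toV ι (u₁ t)) (toV ι (u₂ t)) (θ t ω)) ≤
      ENNReal.ofReal Λ) :
    ‖u₁ b - u₂ b‖ ^ 2 ≤ Real.exp (2 * Λ) * (Real.exp (-(2 * κ * (b - a))) * ‖u₁ a - u₂ a‖ ^ 2 +
      2 * C * ∫ t in a..b, ⨆ j, |L j (toV ι (u₁ t - u₂ t))| ^ 2) := by
  set v : ℝ → V := fun t => toV ι (u₁ t) - toV ι (u₂ t) with hv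
  set f : ℝ → H := fun t => F (toV ι (u₁ t)) (θ t ω) - F (toV ι (u₂ t)) (θ t ω) with hf
  set lam : ℝ → ℝ := fun t => l (toV ι (u₁ t)) (toV ι (u₂ t)) (θ t ω) with hlam
  set N : ℝ → ℝ := fun t => ⨆ j, |L j (toV ι (u₁ t - u₂ t))| ^ 2 with hN
  have hr₁ : ∀ t ∈ Icc a b, u₁ t ∈ range ι := fun t ht => image_subset_range _ _ (hmem₁ t ht)
  have hr₂ : ∀ t ∈ Icc a b, u₂ t ∈ range ι := fun t ht => image_subset_range _ _ (hmem₂ t ht)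
  have hιv : ∀ t ∈ Icc a b, ι (v t) = u₁ t - u₂ t := fun t ht => by
    rw [hv, map_sub, ι_toV hι (hr₁ t ht), ι_toV hι (hr₂ t ht)]
  have hvN : ∀ t ∈ Icc a b, N t = ⨆ j, |L j (v t)| ^ 2 := fun t ht => by
    simp only [hN, hv, toV_sub hι (hr₁ t ht) (hr₂ t ht)]
  have hcont : ContinuousOn (fun t => ι (v t)) (Icc a b) := by
    have hs : Icc a b ⊆ Ici 0 := fun t ht => ha.le.trans ht.1
    exact ((hu₁.continuousOn.mono hs).sub (hu₂.continuousOn.mono hs)).congr hιv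
  have hvL : MemLp v 2 (volume.restrict (Icc a b)) := (hu₁.memLp a b ha).sub (hu₂.memLp a b ha)
  have hfI : IntegrableOn f (Icc a b) := (hu₁.integrableOn a b ha).sub (hu₂.integrableOn a b ha)
  have heq : ∀ y : V, ∀ t ∈ Icc a b,
      ⟪ι (v t), ι y⟫ - ⟪ι (v a), ι y⟫ + ∫ r in a..t, ⟪v r, y⟫ = ∫ r in a..t, ⟪f r, ι y⟫ := by
    intro y t ht
    have e1 := hu₁.equation y a t ha ht.1
    have e2 := hu₂.equation y a t ha ht.1
    simp only [toDual_apply, energyOp_apply] at e1 e2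
    have i1 : ∀ {g : ℝ → V}, MemLp g 2 (volume.restrict (Icc a t)) →
        IntervalIntegrable (fun r => ⟪g r, y⟫) volume a t := fun hg =>
      (intervalIntegrable_iff_integrableOn_Icc_of_le ht.1).2
        ((hg.integrable (by norm_num)).inner_const y)
    have i2 : ∀ {g : ℝ → H}, IntegrableOn g (Icc a t) →
        IntervalIntegrable (fun r => ⟪g r, ι y⟫) volume a t := fun hg =>
      (intervalIntegrable_iff_integrableOn_Icc_of_le ht.1).2 (hg.inner_const (ι y))
    rw [hιv t ht, hιv a (left_mem_Icc.2 hab)]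
    simp only [hv, hf, inner_sub_left]
    rw [intervalIntegral.integral_sub (i1 (hu₁.memLp a t ha)) (i1 (hu₂.memLp a t ha)),
      intervalIntegral.integral_sub (i2 (hu₁.integrableOn a t ha)) (i2 (hu₂.integrableOn a t ha)),
      ← e1, ← e2]
    ring
  set D : ℝ → ℝ := fun r => 2 * (-‖v r‖ ^ 2 + ⟪f r, ι (v r)⟫) with hD
  have henergy : ∀ t ∈ Icc a b, IntervalIntegrable D volume a t ∧
      ‖ι (v t)‖ ^ 2 - ‖ι (v a)‖ ^ 2 = ∫ r in a..t, D r := fun t ht => by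
    have hs : Icc a t ⊆ Icc a b := Icc_subset_Icc_right ht.2
    exact energy_equality hι hc ht.1 (hvL.mono_measure (Measure.restrict_mono hs le_rfl))
      (hfI.mono_set hs) (hcont.mono hs) fun y r hr => heq y r (hs hr)
  have hlamI : IntegrableOn lam (Icc a b) := by
    refine ⟨hl.aestronglyMeasurable, ?_⟩
    rw [hasFiniteIntegral_iff_ofReal (.of_forall fun t => hl0 _ _ _)]
    exact hlΛ.trans_lt ENNReal.ofReal_lt_top
  have hlamII := (intervalIntegrable_iff_integrableOn_Icc_of_le hab).2 hlamI
  have hNI : IntervalIntegrable N volume a b :=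
    intervalIntegrable_functionals hι hu₁ hu₂ L ha hab
  have hN0 : ∀ t, 0 ≤ N t := fun t => Real.iSup_nonneg fun j => by positivity
  -- Twice the dissipativity estimate, with `-c ‖v‖²` replaced by `-κ ‖ι v‖² + C N` from the defect
  -- inequality.
  have hineq : ∀ t ∈ Icc a b, D t ≤ 2 * (lam t - κ) * ‖ι (v t)‖ ^ 2 + 2 * C * N t := by
    intro t ht
    obtain ⟨y₁, hy₁, he₁⟩ := hmem₁ t ht
    obtain ⟨y₂, hy₂, he₂⟩ := hmem₂ t ht
    have ev₁ : toV ι (u₁ t) = y₁ := by rw [← he₁, toV_apply hι]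
    have ev₂ : toV ι (u₂ t) = y₂ := by rw [← he₂, toV_apply hι]
    have h1 := hmono (θ t ω) y₁ hy₁ y₂ hy₂
    simp only [add_apply, neg_apply, toDual_apply, energyOp_apply,
      real_inner_self_eq_norm_sq] at h1
    have h2 := hLC (v t)
    rw [← hvN t ht] at h2
    simp only [hD, hlam, hf, hv, ev₁, ev₂] at h1 h2 ⊢
    linarith
  have key := gronwall_of_primitive_sub (q := fun t => ‖ι (v t)‖ ^ 2) hab hκ
    (henergy b (right_mem_Icc.2 hab)).1 hlamII (hNI.const_mul (2 * C)) (fun t => hl0 _ _ _)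
    (.of_forall fun t _ => mul_nonneg (by positivity) (hN0 t))
    (fun t ht => by linarith [(henergy t ht).2]) (.of_forall hineq)
  rw [intervalIntegral.integral_const_mul] at key
  simp only [hιv a (left_mem_Icc.2 hab), hιv b (right_mem_Icc.2 hab)] at key
  refine key.trans (mul_le_mul_of_nonneg_right (Real.exp_le_exp.2 ?_) ?_)
  · have h1 : ∫ r in a..b, lam r ≤ Λ := by
      rw [intervalIntegral.integral_of_le hab, ← integral_Icc_eq_integral_Ioc,
        ← ENNReal.ofReal_le_ofReal_iff hΛ, ofReal_integral_eq_lintegral_ofReal hlamI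
          (.of_forall fun t => hl0 _ _ _)]
      exact hlΛ
    linarith
  · have : 0 ≤ ∫ t in a..b, N t := intervalIntegral.integral_nonneg hab fun t _ => hN0 t
    positivity

end

variable {V H Ω : Type*} [NormedAddCommGroup V] [InnerProductSpace ℝ V]
  [NormedAddCommGroup H] [InnerProductSpace ℝ H]
  [MeasurableSpace H] [MeasurableSpace Ω] {P : Measure Ω} {θ : ℝ → Ω → Ω} {ι : V →L[ℝ] H}
  {φ : ℝ≥0 → Ω → H → H} {B : Ω → Set V}

theorem IsContinuousRDS.cocycle_real {H : Type*} [TopologicalSpace H] [MeasurableSpace H]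
    {φ : ℝ≥0 → Ω → H → H} (hφ : IsContinuousRDS θ φ) {s t : ℝ} (hs : 0 ≤ s)
    (ht : 0 ≤ t) (ω : Ω) (x : H) :
    φ (s + t).toNNReal ω x = φ t.toNNReal (θ s ω) (φ s.toNNReal ω x) := by
  rw [add_comm, Real.toNNReal_add ht hs, hφ.cocycle, Real.coe_toNNReal _ hs]

theorem IsContinuousRDS.measurable_trajectory {H : Type*} [TopologicalSpace H] [MeasurableSpace H]
    {φ : ℝ≥0 → Ω → H → H} (hφ : IsContinuousRDS θ φ) (ω : Ω) (x : H) :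
    Measurable fun t : ℝ => φ t.toNNReal ω x :=
  hφ.measurable.comp
    (measurable_real_toNNReal.prodMk (measurable_const (a := ω).prodMk (measurable_const (a := x))))

theorem IsForwardInvariant.mem (hB : IsForwardInvariant ι θ φ B) (hφ : IsContinuousRDS θ φ)
    (hθ : IsMetricDynamicalSystem P θ) {t : ℝ} (ht : 0 ≤ t) {ω : Ω} {x : H}
    (hx : x ∈ ι '' B ω) : φ t.toNNReal ω x ∈ ι '' B (θ t ω) := by
  rcases ht.eq_or_lt with rfl | h
  · rw [Real.toNNReal_zero, hφ.zero, hθ.apply_zero]; exact hx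
  · have h1 := hB t.toNNReal ω (Real.toNNReal_pos.2 h) (mem_image_of_mem _ hx)
    rwa [Real.coe_toNNReal _ ht] at h1

/-- The weight integrated over `[0, n]` along two trajectories in the absorbing set is controlled
by the time average of `supWeight` along the orbit of the noise. -/
theorem lintegral_weight_le [CompleteSpace H] (hB : IsForwardInvariant ι θ φ B)
    (hφ : IsContinuousRDS θ φ) (hθ : IsMetricDynamicalSystem P θ) {l : V → V → Ω → ℝ} {m : ℝ}
    (hm : 0 < m) (n : ℝ) {ω : Ω} {x₁ x₂ : H} (hx₁ : x₁ ∈ ι '' B ω) (hx₂ : x₂ ∈ ι '' B ω)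
    (hl : Measurable fun t : ℝ =>
      l (toV ι (φ t.toNNReal ω x₁)) (toV ι (φ t.toNNReal ω x₂)) (θ t ω)) :
    ∫⁻ t in Icc 0 n, ENNReal.ofReal
        (l (toV ι (φ t.toNNReal ω x₁)) (toV ι (φ t.toNNReal ω x₂)) (θ t ω)) ≤
      supWeight ι θ φ B l m ω +
        (ENNReal.ofReal m)⁻¹ * ∫⁻ s in Icc 0 n, supWeight ι θ φ B l m (θ s ω) := by
  -- By forward invariance and the cocycle property, the trajectories restart at time `s` from
  -- points of `B (θ s ω)`, so the window integral is one of the competitors in the supremum at `θ s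
  -- ω`.
  have hsup : ∀ s ∈ Icc 0 n, ∫⁻ t in Icc 0 m, ENNReal.ofReal
      (l (toV ι (φ (s + t).toNNReal ω x₁)) (toV ι (φ (s + t).toNNReal ω x₂)) (θ (s + t) ω)) ≤
      supWeight ι θ φ B l m (θ s ω) := by
    intro s hs
    obtain ⟨y₁, hy₁, he₁⟩ := hB.mem hφ hθ hs.1 hx₁
    obtain ⟨y₂, hy₂, he₂⟩ := hB.mem hφ hθ hs.1 hx₂
    refine le_trans (le_of_eq ?_) (le_iSup₂_of_le y₁ hy₁ (le_iSup₂_of_le y₂ hy₂ le_rfl))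
    refine setLIntegral_congr_fun measurableSet_Icc fun t ht => ?_
    simp only [hφ.cocycle_real hs.1 ht.1, he₁, he₂]
    rw [add_comm s t, hθ.apply_add]
  refine (lintegral_Icc_le_add_windows hl.ennreal_ofReal hm n).trans (add_le_add ?_ ?_)
  · obtain ⟨y₁, hy₁, rfl⟩ := hx₁
    obtain ⟨y₂, hy₂, rfl⟩ := hx₂
    exact le_iSup₂_of_le y₁ hy₁ (le_iSup₂_of_le y₂ hy₂ le_rfl)
  · exact mul_le_mul_right (setLIntegral_mono' measurableSet_Icc hsup) _

variable [CompleteSpace V] [CompleteSpace H] [MeasurableSpace V] [BorelSpace V]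
  [TopologicalSpace.SeparableSpace H] [BorelSpace H]

/-! ### Measurability -/

/-- By the Lusin–Souslin theorem, a continuous injection from the Polish space `V` is a measurable
embedding. Trajectories are measurable in `H`, whereas the weight `l` is evaluated in `V`. -/
theorem measurable_toV (hι : Function.Injective ι) : Measurable (toV ι) := by
  have := separableSpace_of_injective hι
  have : SecondCountableTopology V := UniformSpace.secondCountable_of_separable V
  exact (ι.continuous.measurableEmbedding hι).measurable_extend measurable_id measurable_const

theorem measurable_weight_trajectory (hι : Function.Injective ι) (hφ : IsContinuousRDS θ φ)
    (hθ : IsMetricDynamicalSystem P θ) {l : V → V → Ω → ℝ}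
    (hl : Measurable fun p : V × V × Ω => l p.1 p.2.1 p.2.2) (ω : Ω) (x₁ x₂ : H) :
    Measurable fun t : ℝ =>
      l (toV ι (φ t.toNNReal ω x₁)) (toV ι (φ t.toNNReal ω x₂)) (θ t ω) :=
  hl.comp (((measurable_toV hι).comp (hφ.measurable_trajectory ω x₁)).prodMk
    (((measurable_toV hι).comp (hφ.measurable_trajectory ω x₂)).prodMk (hθ.measurable_orbit ω)))

/-- Membership in a closed set is the vanishing of the distance, which is continuous in the point
and measurable in `ω`, hence jointly measurable by separability. With the extended distance, empty
sets need no separate treatment. -/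
theorem measurableSet_mem_of_measurable_infEDist {H Ω : Type*} [MetricSpace H]
    [SecondCountableTopology H] [MeasurableSpace H] [OpensMeasurableSpace H] [MeasurableSpace Ω]
    {K : Ω → Set H} (hc : ∀ ω, IsClosed (K ω))
    (hm : ∀ h, Measurable fun ω => Metric.infEDist h (K ω)) {y : Ω → H}
    {τ : Ω → Ω} (hy : Measurable y) (hτ : Measurable τ) :
    MeasurableSet {ω | y ω ∈ K (τ ω)} := by
  set d : H → Ω → ℝ≥0∞ := fun h ω => Metric.infEDist h (K ω) with hd
  have h1 : Measurable (Function.uncurry d) :=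
    measurable_uncurry_of_continuous_of_measurable (fun ω => Metric.continuous_infEDist) hm
  have h2 : Measurable fun ω => d (y ω) (τ ω) := h1.comp (hy.prodMk hτ)
  have h3 : {ω | y ω ∈ K (τ ω)} = (fun ω => d (y ω) (τ ω)) ⁻¹' {0} := by
    ext ω
    exact Metric.mem_iff_infEDist_zero_of_closed (hc (τ ω))
  rw [h3]
  exact h2 (measurableSet_singleton 0)
theorem IsCompactRandomSet.measurableSet_mem {V H Ω : Type*} [NormedAddCommGroup V]
    [InnerProductSpace ℝ V] [NormedAddCommGroup H] [InnerProductSpace ℝ H] [MeasurableSpace H]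
    [MeasurableSpace Ω] {ι : V →L[ℝ] H} {B : Ω → Set V} [TopologicalSpace.SeparableSpace H]
    [BorelSpace H] (hB : IsCompactRandomSet ι B) {y : Ω → H}
    {τ : Ω → Ω} (hy : Measurable y) (hτ : Measurable τ) :
    MeasurableSet {ω | y ω ∈ ι '' B (τ ω)} := by
  have : SecondCountableTopology H := UniformSpace.secondCountable_of_separable H
  exact measurableSet_mem_of_measurable_infEDist (fun ω => (hB.isCompact ω).isClosed)
    hB.measurable hy hτ

end Trajectories

/-! ### Convergence in probability -/

section Convergence

/-- If the sum reaches `β`, some term reaches `β / (n + 1)`, and a union bound over the `n` shifted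
windows applies. Dividing by `n + 1` instead of `n` also covers `n = 0` and makes the contradiction
strict. -/
theorem tendsto_measure_sum_ge {Ω : Type*} [MeasurableSpace Ω] {P : Measure Ω}
    {J : ℝ → Ω → ℝ} (hJ : TendstoInMeasure P J atTop fun _ => 0) (n : ℕ) {β : ℝ} (hβ : 0 < β) :
    Tendsto (fun a : ℝ => P {ω | β ≤ ∑ j ∈ Finset.range n, J (a + j) ω}) atTop (𝓝 0) := by
  rw [tendstoInMeasure_iff_dist] at hJ
  have hβn : 0 < β / (n + 1) := by positivity
  have h1 : Tendsto (fun a : ℝ => ∑ j ∈ Finset.range n,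
      P {ω | β / (n + 1) ≤ dist (J (a + j) ω) 0}) atTop (𝓝 0) := by
    have := tendsto_finsetSum (Finset.range n) fun j _ =>
      (hJ _ hβn).comp (tendsto_atTop_add_const_right atTop (j : ℝ) tendsto_id)
    simpa using this
  refine tendsto_of_tendsto_of_tendsto_of_le_of_le tendsto_const_nhds h1 (fun _ => zero_le)
    fun a => ?_
  refine (measure_mono fun ω hω => ?_).trans (measure_biUnion_finset_le (Finset.range n)
    fun j => {ω | β / (n + 1) ≤ dist (J (a + j) ω) 0})
  by_contra hcon
  simp only [mem_iUnion, not_exists, mem_ofPred_eq, not_le, Real.dist_eq, sub_zero] at hcon hω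
  have h2 : ∑ j ∈ Finset.range n, J (a + j) ω ≤ ∑ j ∈ Finset.range n, β / (n + 1) :=
    Finset.sum_le_sum fun j hj => (le_abs_self _).trans (hcon j hj).le
  rw [Finset.sum_const, Finset.card_range, nsmul_eq_mul] at h2
  have h3 : (n : ℝ) * (β / (n + 1)) < β := by
    rw [mul_div_assoc', div_lt_iff₀ (by positivity)]
    nlinarith
  linarith

theorem exists_measure_ge_le {Ω : Type*} [MeasurableSpace Ω] {P : Measure Ω} [IsFiniteMeasure P]
    {X : Ω → ℝ} (hX : Measurable X) {η : ℝ≥0∞} (hη : 0 < η) :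
    ∃ K : ℝ, 0 < K ∧ P {ω | K ≤ X ω} ≤ η := by
  have h1 : Tendsto (fun n : ℕ => P {ω | (n : ℝ) ≤ X ω}) atTop (𝓝 0) := by
    have h2 := tendsto_measure_iInter_atTop (μ := P) (s := fun n : ℕ => {ω | (n : ℝ) ≤ X ω})
      (fun n => (measurableSet_le measurable_const hX).nullMeasurableSet)
      (fun m n hmn ω (hω : (n : ℝ) ≤ X ω) => show (m : ℝ) ≤ X ω from
        (Nat.cast_le.2 hmn).trans hω) ⟨0, measure_ne_top _ _⟩
    have h3 : ⋂ n : ℕ, {ω | (n : ℝ) ≤ X ω} = ∅ := by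
      ext ω
      simp only [mem_iInter, mem_ofPred_eq, mem_empty_iff_false, iff_false, not_forall, not_le]
      exact exists_nat_gt _
    rwa [h3, measure_empty] at h2
  obtain ⟨n, hn, hn0⟩ := (((ENNReal.tendsto_nhds_zero.1 h1) η hη).and
    (eventually_ne_atTop 0)).exists
  exact ⟨n, by positivity, hn⟩

theorem norm_sub_sq_le_of_supNormSq_le {V H : Type*} [NormedAddCommGroup V]
    [InnerProductSpace ℝ V] [NormedAddCommGroup H] [InnerProductSpace ℝ H] {ι : V →L[ℝ] H}
    {S : Set V} {r : ℝ} (hr : 0 ≤ r) (hS : supNormSq S ≤ ENNReal.ofReal r) {x₁ x₂ : H}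
    (h₁ : x₁ ∈ ι '' S) (h₂ : x₂ ∈ ι '' S) : ‖x₁ - x₂‖ ^ 2 ≤ 4 * ‖ι‖ ^ 2 * r := by
  have hle : ∀ v ∈ S, ‖v‖ ^ 2 ≤ r := fun v hv =>
    (ENNReal.ofReal_le_ofReal_iff hr).1 ((le_iSup₂_of_le v hv le_rfl).trans hS)
  obtain ⟨v, hv, rfl⟩ := h₁
  obtain ⟨w, hw, rfl⟩ := h₂
  rw [← map_sub]
  have h3 : ‖v - w‖ ^ 2 ≤ 4 * r := by
    have := parallelogram_law_with_norm ℝ v w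
    nlinarith [hle v hv, hle w hw, norm_nonneg (v + w)]
  calc ‖ι (v - w)‖ ^ 2 ≤ (‖ι‖ * ‖v - w‖) ^ 2 := by gcongr; exact ι.le_opNorm _
    _ = ‖ι‖ ^ 2 * ‖v - w‖ ^ 2 := mul_pow _ _ _
    _ ≤ ‖ι‖ ^ 2 * (4 * r) := by gcongr
    _ = _ := by ring

/-- Choice of the decay rates from the condition on the completeness defect. -/
theorem exists_rates {E ε : ℝ≥0∞} {c : ℝ} (hc : 0 < c) (hε : ε ≠ ∞)
    (h : E < ENNReal.ofReal c * (ε ^ 2)⁻¹) :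
    ∃ κ' κ : ℝ, 0 ≤ κ' ∧ κ' < κ ∧ E < ENNReal.ofReal κ' ∧ κ * ε.toReal ^ 2 < c := by
  -- Two rates fit into the strict inequality: `κ'` will bound the average weight and `κ` is the
  -- damping left by the functionals; `κ - κ'` is the net rate of decay.
  obtain ⟨κ, hκ, h1, h2⟩ := ENNReal.lt_iff_exists_real_btwn.1 h
  obtain ⟨κ', hκ', h3, h4⟩ := ENNReal.lt_iff_exists_real_btwn.1 h1
  refine ⟨κ', κ, hκ', ?_, h3, ?_⟩
  · by_contra hcon
    exact (h4.trans_le (ENNReal.ofReal_le_ofReal (not_lt.1 hcon))).false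
  -- For `ε = 0` the upper bound on `κ` was `∞`, and the claim reduces to `0 < c`.
  · rcases eq_or_ne ε 0 with rfl | h0
    · simpa using hc
    rw [← div_eq_mul_inv, ENNReal.lt_div_iff_mul_lt (Or.inl (pow_ne_zero 2 h0))
      (Or.inl (ENNReal.pow_ne_top hε)), ← ENNReal.ofReal_toReal hε,
      ← ENNReal.ofReal_pow ENNReal.toReal_nonneg, ← ENNReal.ofReal_mul hκ] at h2
    exact (ENNReal.ofReal_lt_ofReal_iff hc).1 h2

/-- Passing to the complement of the absorption event requires its measurability, which comes from
compactness and the measurable distance function of the random set. -/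
theorem IsForwardAbsorbing.eventually_measure_compl_le {V H Ω : Type*}
    [NormedAddCommGroup V] [InnerProductSpace ℝ V] [NormedAddCommGroup H] [InnerProductSpace ℝ H]
    [TopologicalSpace.SeparableSpace H] [MeasurableSpace H] [BorelSpace H] [MeasurableSpace Ω]
    {P : Measure Ω} {θ : ℝ → Ω → Ω} {ι : V →L[ℝ] H} {φ : ℝ≥0 → Ω → H → H} {B : Ω → Set V}
    [IsProbabilityMeasure P]
    (hBabs : IsForwardAbsorbing P ι θ φ B) (hB : IsCompactRandomSet ι B)
    (hθ : IsMetricDynamicalSystem P θ) (hφ : IsContinuousRDS θ φ) {x : Ω → H}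
    (hx : Measurable x) {η : ℝ} (hη : 0 < η) :
    ∀ᶠ a : ℝ in atTop, P {ω | φ a.toNNReal ω (x ω) ∈ ι '' B (θ a ω)}ᶜ ≤ ENNReal.ofReal η := by
  obtain ⟨T, -, hT⟩ := hBabs x hx η hη
  filter_upwards [eventually_ge_atTop (T : ℝ), eventually_ge_atTop 0] with a ha ha0
  have h1 := hT a.toNNReal (by rwa [← NNReal.coe_le_coe, Real.coe_toNNReal _ ha0])
  rw [Real.coe_toNNReal _ ha0] at h1
  have hy : Measurable fun ω => φ a.toNNReal ω (x ω) :=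
    hφ.measurable.comp ((measurable_const (a := a.toNNReal)).prodMk (measurable_id.prodMk hx))
  rw [prob_compl_eq_one_sub (hB.measurableSet_mem hy (hθ.measurable_apply a))]
  refine (tsub_le_tsub_left h1 1).trans ?_
  rw [tsub_le_iff_right, ← ENNReal.ofReal_one]
  refine (ENNReal.ofReal_le_ofReal ?_).trans ENNReal.ofReal_add_le
  linarith

variable {V H Ω : Type*}
  [NormedAddCommGroup V] [InnerProductSpace ℝ V] [CompleteSpace V]
  [MeasurableSpace V] [BorelSpace V]
  [NormedAddCommGroup H] [InnerProductSpace ℝ H] [CompleteSpace H]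
  [TopologicalSpace.SeparableSpace H] [MeasurableSpace H] [BorelSpace H]
  [MeasurableSpace Ω] {P : Measure Ω} {θ : ℝ → Ω → Ω} {ι : V →L[ℝ] H} {F : V → Ω → H}
  {φ : ℝ≥0 → Ω → H → H} {B : Ω → Set V} {l : V → V → Ω → ℝ}

/-- The distance at time `a + n` of two trajectories that enter the absorbing set at time `a`. -/
theorem norm_sub_sq_le_of_mem_absorbing (hθ : IsMetricDynamicalSystem P θ)
    (hι : Function.Injective ι) (hcι : IsCompactOperator ι)
    (hφ : IsContinuousRDS θ φ) (hgen : IsGeneratedBy ι F θ φ)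
    (hBinv : IsForwardInvariant ι θ φ B) {k : ℕ} (L : Fin k → StrongDual ℝ V)
    (hl : Measurable (fun p : V × V × Ω => l p.1 p.2.1 p.2.2)) (hl0 : ∀ x₁ x₂ ω, 0 ≤ l x₁ x₂ ω)
    {c κ C m : ℝ} (hm : 0 < m) (hκ : 0 ≤ κ) (hC : 0 ≤ C)
    (hLC : ∀ v : V, κ * ‖ι v‖ ^ 2 ≤ c * ‖v‖ ^ 2 + C * ⨆ j, |L j v| ^ 2)
    (hmono : ∀ ω, ∀ x₁ ∈ B ω, ∀ x₂ ∈ B ω,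
      (-energyOp (x₁ - x₂) + toDual ι (F x₁ ω - F x₂ ω)) (x₁ - x₂)
        ≤ -c * ‖x₁ - x₂‖ ^ 2 + l x₁ x₂ ω * ‖ι (x₁ - x₂)‖ ^ 2)
    {ω : Ω} {a n Λ : ℝ} (ha : 0 < a) (hn : 0 ≤ n) (hΛ : 0 ≤ Λ) {y₁ y₂ : H}
    (h₁ : φ a.toNNReal ω y₁ ∈ ι '' B (θ a ω)) (h₂ : φ a.toNNReal ω y₂ ∈ ι '' B (θ a ω))
    (hΛle : supWeight ι θ φ B l m (θ a ω) + (ENNReal.ofReal m)⁻¹ *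
      ∫⁻ s in Icc 0 n, supWeight ι θ φ B l m (θ s (θ a ω)) ≤ ENNReal.ofReal Λ) :
    ‖φ (a + n).toNNReal ω y₁ - φ (a + n).toNNReal ω y₂‖ ^ 2 ≤
      Real.exp (2 * Λ) * (Real.exp (-(2 * κ * n)) *
        ‖φ a.toNNReal ω y₁ - φ a.toNNReal ω y₂‖ ^ 2 + 2 * C * ∫ t in a..(a + n),
          ⨆ j, |L j (toV ι (φ t.toNNReal ω y₁ - φ t.toNNReal ω y₂))| ^ 2) := by
  have hmem : ∀ y, φ a.toNNReal ω y ∈ ι '' B (θ a ω) → ∀ t ∈ Icc a (a + n),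
      φ t.toNNReal ω y ∈ ι '' B (θ t ω) := by
    intro y hy t ht
    have h3 := hBinv.mem hφ hθ (sub_nonneg.2 ht.1) hy
    rwa [← hφ.cocycle_real ha.le (sub_nonneg.2 ht.1), ← hθ.apply_add, add_sub_cancel,
      sub_add_cancel] at h3
  have hmeas := measurable_weight_trajectory hι hφ hθ hl
  have hlΛ : ∫⁻ t in Icc a (a + n), ENNReal.ofReal
      (l (toV ι (φ t.toNNReal ω y₁)) (toV ι (φ t.toNNReal ω y₂)) (θ t ω)) ≤
      ENNReal.ofReal Λ := by
    have h3 := lintegral_Icc_add_right (hmeas ω y₁ y₂).ennreal_ofReal 0 n a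
    rw [zero_add, add_comm n a] at h3
    rw [← h3]
    refine le_trans (le_of_eq ?_) ((lintegral_weight_le hBinv hφ hθ hm n h₁ h₂
      (hmeas _ _ _)).trans hΛle)
    refine setLIntegral_congr_fun measurableSet_Icc fun t ht => ?_
    simp only [add_comm t a, hφ.cocycle_real ha.le ht.1]
    rw [add_comm a t, hθ.apply_add]
  have key := norm_sub_sq_le_of_dissipative hι hcι (hgen ω y₁) (hgen ω y₂) L hl0 ha
    (le_add_of_nonneg_right hn) hκ hC hΛ hLC hmono (hmem y₁ h₁) (hmem y₂ h₂) (hmeas ω y₁ y₂) hlΛ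
  rwa [add_sub_cancel_left] at key

end Convergence

end DetFunctionals

/-! ### The determining property -/

theorem theorem1
    {V H Ω : Type*}
    [NormedAddCommGroup V] [InnerProductSpace ℝ V] [CompleteSpace V]
    [MeasurableSpace V] [BorelSpace V]
    [NormedAddCommGroup H] [InnerProductSpace ℝ H] [CompleteSpace H]
    [TopologicalSpace.SeparableSpace H] [MeasurableSpace H] [BorelSpace H]
    [MeasurableSpace Ω] (P : Measure Ω) [IsProbabilityMeasure P]
    (θ : ℝ → Ω → Ω) (hθ : DetFunctionals.IsMetricDynamicalSystem P θ)
    (ι : V →L[ℝ] H) (A R : H →ₗ.[ℝ] H) (hA : DetFunctionals.IsEnergyTriple ι A R)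
    (F : V → Ω → H) (hF : ∀ u, Measurable (F u))
    (φ : ℝ≥0 → Ω → H → H) (hφ : DetFunctionals.IsContinuousRDS θ φ)
    (hgen : DetFunctionals.IsGeneratedBy ι F θ φ)
    (B : Ω → Set V) (hB : DetFunctionals.IsCompactRandomSet ι B)
    (hBinv : DetFunctionals.IsForwardInvariant ι θ φ B)
    (hBabs : DetFunctionals.IsForwardAbsorbing P ι θ φ B)
    (ρ : Ω → ℝ) (hρ : DetFunctionals.IsTempered P θ ρ)
    (hBρ : ∀ᵐ ω ∂P, DetFunctionals.supNormSq (B ω) ≤ ENNReal.ofReal (ρ ω))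
    (hBloc : ∀ᵐ ω ∂P, AEMeasurable (fun t : ℝ => DetFunctionals.supNormSq (B (θ t ω))) ∧
      ∀ a b : ℝ, ∫⁻ t in Icc a b, DetFunctionals.supNormSq (B (θ t ω)) < ∞)
    {k : ℕ} (L : Fin k → StrongDual ℝ V) (hL : LinearIndependent ℝ L)
    (c : ℝ) (hc : 0 < c)
    (l : V → V → Ω → ℝ) (hl : Measurable (fun p : V × V × Ω => l p.1 p.2.1 p.2.2))
    (hl0 : ∀ x₁ x₂ ω, 0 ≤ l x₁ x₂ ω)
    (hmono : ∀ ω, ∀ x₁ ∈ B ω, ∀ x₂ ∈ B ω,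
      (-DetFunctionals.energyOp (x₁ - x₂) + DetFunctionals.toDual ι (F x₁ ω - F x₂ ω)) (x₁ - x₂)
        ≤ -c * ‖x₁ - x₂‖ ^ 2 + l x₁ x₂ ω * ‖ι (x₁ - x₂)‖ ^ 2)
    (m : ℝ) (hm : 0 < m)
    (hmeas : AEMeasurable (DetFunctionals.supWeight ι θ φ B l m) P)
    (hE : (ENNReal.ofReal m)⁻¹ * ∫⁻ ω, DetFunctionals.supWeight ι θ φ B l m ω ∂P
      < ENNReal.ofReal c * (DetFunctionals.completenessDefect ι L ^ 2)⁻¹) :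
    DetFunctionals.IsDeterminingInProbability P ι φ L := by
  have hι := hA.injective
  -- the growth rates
  set g : Ω → ℝ≥0∞ := hmeas.mk _ with hg
  have hgm : Measurable g := hmeas.measurable_mk
  have hgeq : DetFunctionals.supWeight ι θ φ B l m =ᵐ[P] g := hmeas.ae_eq_mk
  rw [lintegral_congr_ae hgeq] at hE
  have hε := DetFunctionals.completenessDefect_ne_top ι L
  obtain ⟨κ', κ, hκ', hκ'κ, hEκ', hκc⟩ := DetFunctionals.exists_rates hc hε hE
  have hκ : 0 ≤ κ := hκ'.trans hκ'κ.le
  obtain ⟨C, hC, hLC⟩ := DetFunctionals.exists_norm_sq_le_of_defect ι L hκ hκc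
  have hminv : (ENNReal.ofReal m)⁻¹ ≠ ∞ := ENNReal.inv_ne_top.2 (by simpa using hm)
  set f : Ω → ℝ≥0∞ := fun ω => (ENNReal.ofReal m)⁻¹ * g ω with hf
  have hfm : Measurable f := hgm.const_mul _
  have hfE : ∫⁻ ω, f ω ∂P < ENNReal.ofReal κ' := by
    rwa [hf, lintegral_const_mul _ hgm]
  have hgfin : ∀ᵐ ω ∂P, g ω < ∞ := by
    refine ae_lt_top hgm fun htop => ?_
    rw [htop, ENNReal.mul_top (ENNReal.inv_ne_zero.2 ENNReal.ofReal_ne_top)] at hE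
    exact not_top_lt hE
  -- the properties of the noise at the time of entrance that hold almost surely
  have hgood : ∀ᵐ ω ∂P, DetFunctionals.supWeight ι θ φ B l m ω = g ω ∧ g ω < ∞ ∧
      DetFunctionals.supNormSq (B ω) ≤ ENNReal.ofReal (ρ ω) ∧
      ∀ᵐ s : ℝ, DetFunctionals.supWeight ι θ φ B l m (θ s ω) = g (θ s ω) := by
    filter_upwards [hgeq, hgfin, hBρ, hθ.ae_ae_orbit hgeq] with ω h1 h2 h3 h4
      using ⟨h1, h2, h3, h4⟩
  -- `X` collects the random factors at the entrance time: the leftover `supWeight` term in the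
  -- exponent and the squared initial distance. Because of the `+ 1`, the bound `X < K` also
  -- controls `exp (2 g)` alone.
  set X : Ω → ℝ := fun ω => Real.exp (2 * (g ω).toReal) * (4 * ‖ι‖ ^ 2 * ρ ω + 1) with hX
  have hXm : Measurable X :=
    ((hgm.ennreal_toReal.const_mul 2).exp).mul ((hρ.measurable.const_mul _).add_const 1)
  intro x₁ x₂ hx₁ hx₂ hJ
  set J : ℝ → Ω → ℝ := fun t ω => ∫ τ in t..(t + 1),
    ⨆ j, |L j (DetFunctionals.toV ι (φ τ.toNNReal ω (x₁ ω) - φ τ.toNNReal ω (x₂ ω)))| ^ 2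
    with hJdef
  rw [tendstoInMeasure_iff_dist]
  intro δ hδ
  rw [ENNReal.tendsto_nhds_zero]
  intro η hη
  -- Five exceptional events share `η`: large `X`, large average weight, late absorption of either
  -- trajectory, and large functionals.
  obtain ⟨η', hη'0, hη'⟩ : ∃ η' : ℝ, 0 < η' ∧ 5 * ENNReal.ofReal η' ≤ η := by
    obtain ⟨r, hr0, hr⟩ := ENNReal.lt_iff_exists_nnreal_btwn.1 hη
    refine ⟨r / 5, by have : (0 : ℝ) < r := by exact_mod_cast hr0
                      positivity, ?_⟩
    rw [ENNReal.ofReal_div_of_pos (by norm_num), ENNReal.ofReal_coe_nnreal]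
    norm_num
    rw [ENNReal.mul_div_cancel (by norm_num) (by norm_num)]
    exact hr.le
  have hη'pos : 0 < ENNReal.ofReal η' := ENNReal.ofReal_pos.2 hη'0
  obtain ⟨K, hK0, hK⟩ := DetFunctionals.exists_measure_ge_le (P := P) hXm hη'pos
  -- the length of the time window
  obtain ⟨n, hn1, hn2⟩ : ∃ n : ℕ, Real.exp (-(2 * (κ - κ') * n)) * K < δ ^ 2 / 2 ∧
      P {ω | ENNReal.ofReal (n * κ') ≤ ∫⁻ r in Icc 0 (n : ℝ), f (θ r ω)} ≤ ENNReal.ofReal η' := by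
    have h1 : Tendsto (fun n : ℕ => Real.exp (-(2 * (κ - κ') * n)) * K) atTop (𝓝 (0 * K)) := by
      refine Tendsto.mul_const K (Real.tendsto_exp_neg_atTop_nhds_zero.comp ?_)
      exact tendsto_natCast_atTop_atTop.const_mul_atTop (by linarith)
    rw [zero_mul] at h1
    exact ((h1.eventually_lt_const (by positivity)).and
      ((ENNReal.tendsto_nhds_zero.1 (hθ.tendsto_measure_le_lintegral_orbit hfm hfE))
        _ hη'pos)).exists
  -- The threshold for the functionals is chosen after `n`, since it must offset the growth factor
  -- `exp (2 n κ')`, which is now a constant.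
  obtain ⟨β, hβ0, hβ⟩ : ∃ β > 0, K * (Real.exp (2 * (n * κ')) * (2 * C * β)) ≤ δ ^ 2 / 2 := by
    have h0 : 0 ≤ K * (Real.exp (2 * (n * κ')) * (2 * C)) := by positivity
    refine ⟨δ ^ 2 / 2 / (K * (Real.exp (2 * (n * κ')) * (2 * C)) + 1), by positivity, ?_⟩
    have h1 : K * (Real.exp (2 * (n * κ')) * (2 * C)) *
        (δ ^ 2 / 2 / (K * (Real.exp (2 * (n * κ')) * (2 * C)) + 1)) ≤ δ ^ 2 / 2 := by
      rw [mul_div_assoc', div_le_iff₀ (by linarith)]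
      nlinarith [sq_nonneg δ]
    linarith
  have hshift : Tendsto (fun t : ℝ => t - n) atTop atTop :=
    tendsto_atTop_add_const_right atTop (-(n : ℝ)) tendsto_id
  have hJn := (ENNReal.tendsto_nhds_zero.1 (DetFunctionals.tendsto_measure_sum_ge hJ n hβ0)) _
    hη'pos
  filter_upwards [hshift.eventually (eventually_gt_atTop 0), hshift.eventually hJn,
    hshift.eventually (hBabs.eventually_measure_compl_le hB hθ hφ hx₁ hη'0),
    hshift.eventually (hBabs.eventually_measure_compl_le hB hθ hφ hx₂ hη'0)]
    with t ha hJa hab₁ hab₂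
  set a := t - n with hadef
  have hat : a + n = t := by rw [hadef]; ring
  -- Stationarity: the exceptional events for the noise at the entrance time are preimages under `θ
  -- a` of fixed events, so their probabilities do not depend on `a`.
  have hpres := hθ.measurePreserving a
  set N : Set Ω := {ω | ¬ (DetFunctionals.supWeight ι θ φ B l m ω = g ω ∧ g ω < ∞ ∧
      DetFunctionals.supNormSq (B ω) ≤ ENNReal.ofReal (ρ ω) ∧
      ∀ᵐ s : ℝ, DetFunctionals.supWeight ι θ φ B l m (θ s ω) = g (θ s ω))} with hN
  have hN0 : P (θ a ⁻¹' N) = 0 :=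
    hpres.quasiMeasurePreserving.preimage_null (ae_iff.1 hgood)
  set S₁ : Set Ω := {ω | K ≤ X ω} with hS₁
  set S₂ : Set Ω := {ω | ENNReal.ofReal (n * κ') ≤ ∫⁻ r in Icc 0 (n : ℝ), f (θ r ω)} with hS₂
  have hS₁m : MeasurableSet S₁ := measurableSet_le measurable_const hXm
  have hS₂m : MeasurableSet S₂ :=
    measurableSet_le measurable_const (hθ.measurable_lintegral_orbit hfm _)
  have hS₁P : P (θ a ⁻¹' S₁) ≤ ENNReal.ofReal η' := by
    rwa [hpres.measure_preimage hS₁m.nullMeasurableSet]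
  have hS₂P : P (θ a ⁻¹' S₂) ≤ ENNReal.ofReal η' := by
    rwa [hpres.measure_preimage hS₂m.nullMeasurableSet]
  set A₁ : Set Ω := {ω | φ a.toNNReal ω (x₁ ω) ∈ ι '' B (θ a ω)}ᶜ with hA₁
  set A₂ : Set Ω := {ω | φ a.toNNReal ω (x₂ ω) ∈ ι '' B (θ a ω)}ᶜ with hA₂
  set S₃ : Set Ω := {ω | β ≤ ∑ j ∈ Finset.range n, J (a + j) ω} with hS₃
  have hcover : {ω | δ ≤ dist ‖φ t.toNNReal ω (x₁ ω) - φ t.toNNReal ω (x₂ ω)‖ 0} ⊆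
      θ a ⁻¹' N ∪ (θ a ⁻¹' S₁ ∪ (θ a ⁻¹' S₂ ∪ (A₁ ∪ (A₂ ∪ S₃)))) := by
    intro ω hω
    by_contra hcon
    simp only [mem_union, not_or, mem_preimage, hN, hS₁, hS₂, hA₁, hA₂, hS₃, mem_compl_iff,
      mem_ofPred_eq, not_not, not_le] at hcon
    obtain ⟨⟨hw1, hw2, hw3, hw4⟩, hXK, herg, hb₁, hb₂, hsum⟩ := hcon
    replace hω : δ ≤ ‖φ t.toNNReal ω (x₁ ω) - φ t.toNNReal ω (x₂ ω)‖ := by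
      simpa [mem_ofPred_eq, Real.dist_eq] using hω
    have hΛle : DetFunctionals.supWeight ι θ φ B l m (θ a ω) + (ENNReal.ofReal m)⁻¹ *
        ∫⁻ s in Icc 0 (n : ℝ), DetFunctionals.supWeight ι θ φ B l m (θ s (θ a ω)) ≤
        ENNReal.ofReal ((g (θ a ω)).toReal + n * κ') := by
      rw [ENNReal.ofReal_add ENNReal.toReal_nonneg (by positivity), ENNReal.ofReal_toReal hw2.ne,
        hw1, lintegral_congr_ae (ae_restrict_of_ae hw4),
        ← lintegral_const_mul' _ _ hminv]
      exact add_le_add_right herg.le _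
    have key := DetFunctionals.norm_sub_sq_le_of_mem_absorbing hθ hι hA.compact hφ hgen hBinv L
      hl hl0 hm hκ hC hLC hmono ha n.cast_nonneg
      (add_nonneg ENNReal.toReal_nonneg (by positivity)) hb₁ hb₂ hΛle
    have hstart := DetFunctionals.norm_sub_sq_le_of_supNormSq_le (hρ.nonneg _) hw3 hb₁ hb₂
    have hint : ∫ τ in a..(a + n), ⨆ j, |L j (DetFunctionals.toV ι
        (φ τ.toNNReal ω (x₁ ω) - φ τ.toNNReal ω (x₂ ω)))| ^ 2 =
        ∑ j ∈ Finset.range n, J (a + j) ω := by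
      have := intervalIntegral.sum_integral_adjacent_intervals (μ := volume)
        (f := fun τ : ℝ => ⨆ j, |L j (DetFunctionals.toV ι
          (φ τ.toNNReal ω (x₁ ω) - φ τ.toNNReal ω (x₂ ω)))| ^ 2)
        (a := fun j : ℕ => a + j) (n := n) fun j _ =>
          DetFunctionals.intervalIntegrable_functionals hι (hgen ω (x₁ ω)) (hgen ω (x₂ ω)) L
            (by positivity) (by push_cast; linarith)
      simp only [Nat.cast_zero, add_zero] at this
      rw [← this]
      refine Finset.sum_congr rfl fun j _ => ?_
      simp only [hJdef, Nat.cast_add, Nat.cast_one, add_assoc]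
    rw [hint, hat] at key
    set I := ∑ j ∈ Finset.range n, J (a + j) ω with hI
    set G := (g (θ a ω)).toReal with hG
    have hXa : Real.exp (2 * G) * (4 * ‖ι‖ ^ 2 * ρ (θ a ω) + 1) < K := hXK
    have hρ0 := hρ.nonneg (θ a ω)
    have hexp : Real.exp (2 * (G + n * κ')) * Real.exp (-(2 * κ * n)) =
        Real.exp (2 * G) * Real.exp (-(2 * (κ - κ') * n)) := by
      rw [← Real.exp_add, ← Real.exp_add]; congr 1; ring
    have hexp' : Real.exp (2 * (G + n * κ')) = Real.exp (2 * G) * Real.exp (2 * (n * κ')) := by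
      rw [← Real.exp_add]; congr 1; ring
    have hG1 : Real.exp (2 * G) ≤ K := by
      have : 0 ≤ Real.exp (2 * G) * (4 * ‖ι‖ ^ 2 * ρ (θ a ω)) := by positivity
      linarith
    have hG2 : Real.exp (2 * G) * (4 * ‖ι‖ ^ 2 * ρ (θ a ω)) ≤ K := by
      have := Real.exp_pos (2 * G)
      linarith
    have hfirst : Real.exp (2 * (G + n * κ')) * (Real.exp (-(2 * κ * n)) *
        ‖φ a.toNNReal ω (x₁ ω) - φ a.toNNReal ω (x₂ ω)‖ ^ 2) < δ ^ 2 / 2 := by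
      rw [← mul_assoc, hexp]
      calc _ ≤ Real.exp (2 * G) * Real.exp (-(2 * (κ - κ') * n)) *
            (4 * ‖ι‖ ^ 2 * ρ (θ a ω)) := by gcongr
        _ = Real.exp (-(2 * (κ - κ') * n)) *
            (Real.exp (2 * G) * (4 * ‖ι‖ ^ 2 * ρ (θ a ω))) := by ring
        _ ≤ Real.exp (-(2 * (κ - κ') * n)) * K := by gcongr
        _ < _ := hn1
    have hsecond : Real.exp (2 * (G + n * κ')) * (2 * C * I) ≤ δ ^ 2 / 2 := by
      rw [hexp', mul_assoc]
      calc _ ≤ Real.exp (2 * G) * (Real.exp (2 * (n * κ')) * (2 * C * β)) := by gcongr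
        _ ≤ K * (Real.exp (2 * (n * κ')) * (2 * C * β)) := by gcongr
        _ ≤ _ := hβ
    have hsq := pow_le_pow_left₀ hδ.le hω 2
    rw [mul_add] at key
    linarith
  calc P _ ≤ P (θ a ⁻¹' N ∪ (θ a ⁻¹' S₁ ∪ (θ a ⁻¹' S₂ ∪ (A₁ ∪ (A₂ ∪ S₃))))) :=
        measure_mono hcover
    _ ≤ P (θ a ⁻¹' N) + (P (θ a ⁻¹' S₁) + (P (θ a ⁻¹' S₂) + (P A₁ + (P A₂ + P S₃)))) := by
        refine (measure_union_le _ _).trans (add_le_add_right ?_ _)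
        refine (measure_union_le _ _).trans (add_le_add_right ?_ _)
        refine (measure_union_le _ _).trans (add_le_add_right ?_ _)
        refine (measure_union_le _ _).trans (add_le_add_right ?_ _)
        exact measure_union_le _ _
    _ ≤ 0 + (ENNReal.ofReal η' + (ENNReal.ofReal η' + (ENNReal.ofReal η' +
          (ENNReal.ofReal η' + ENNReal.ofReal η')))) := by
        gcongr
        exact hN0.le
    _ = 5 * ENNReal.ofReal η' := by ring
    _ ≤ η := hη'
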